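/- Conventions. A digraph $G=(V,E)$ has no loops ($E\subseteq V\times V$ avoids the diagonal), and we write $v\rightsquigarrow w$ for $(v,w)\in E$; $\operatorname{Hom}(G',G)$ is the set of edge-preserving maps $V'\to V$. A rooted tree is a digraph with a vertex $r$ such that each vertex is reached from $r$ by a unique directed path. All measures are Borel probability measures on $\mathbb{R}$; $m_k(\mu)=\int x^k\,d\mu$, and $\operatorname{rad}(\mu)=\sup\{|x|: x\in\operatorname{supp}\mu\}$. Let $(\mathcal{H}_v,\xi_v)_{v\in V}$ be Hilbert spaces with unit vectors and $\mathcal{H}_v^\circ=\xi_v^\perp$. Their $G$-free product is $$\mathcal{H}=\mathbb{C}\xi\oplus\bigoplus_{m\ge 0}\ \bigoplus_{v_m\rightsquigarrow\cdots\rightsquigarrow v_1\rightsquigarrow v_0}\mathcal{H}_{v_0}^\circ\otimes\cdots\otimes\mathcal{H}_{v_m}^\circ .$$ For $v\in V$ let $\mathcal{H}_{\rightsquigarrow v}$ be the sum of $\mathbb{C}\xi$ and of the summands with $v_0\rightsquigarrow v$, and let $\mathcal{H}_{\perp v}$ be the sum of the summands with $v_0\ne v$ and $v_0\not\rightsquigarrow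 v$. Then $\mathcal{H}\cong(\mathcal{H}_v\otimes\mathcal{H}_{\rightsquigarrow v})\oplus\mathcal{H}_{\perp v}$, and for $a\in B(\mathcal{H}_v)$ we put $\iota_v(a)=(a\otimes 1)\oplus 0$. For finite $G$ and compactly supported $\mu$, $\boxplus_G(\mu)$ is the spectral distribution, in the vector state of $\xi$, of $\sum_{v\in V}\iota_v(x_v)$, where for every $v$ one takes $(\mathcal{H}_v,\xi_v)=(L^2(\mathbb{R},\mu),1)$ and $x_v$ is multiplication by the coordinate. For $k\ge1$ the boolean cumulants are $\kappa_k(\mu)=\sum_{\pi}(-1)^{|\pi|-1}\prod_{B\in\pi}m_{|B|}(\mu)$, summed over the partitions $\pi$ of $[k]=\{1,\dots,k\}$ into intervals, and $\kappa_\pi(\mu)=\prod_{B\in\pi}\kappa_{|B|}(\mu)$ for a partition $\pi$. For compactly supported $\mu$ and $t>0$, the boolean convolution power $\mu^{\uplus t}$ is the compactly supported probability measure with $\kappa_k(\mu^{\uplus t})=t\,\kappa_k(\mu)$ for all $k\ge1$. Let $\mathcal{NC}_k$ be the set of non-crossing partitions of $[k]$. For blocks $B,B'$ of $\pi\in\mathcal{NC}_k$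 write $B\prec B'$ if there are $i<j$ in $B$ with $B'\subseteq\{i+1,\dots,j-1\}\subseteq[k]\setminus B$. The nesting forest $\mathrm{F}(\pi)$ is the digraph on the blocks of $\pi$ whose edges are the covering pairs of $\prec$; it is a disjoint union of rooted trees. Statement. Let $G_n=(V_n,E_n)$ be a sequence of finite digraphs with $V_n\neq\varnothing$ such that for every finite rooted tree $G'=(V',E')$ $$\lim_{n\to\infty}\frac{|\operatorname{Hom}(G',G_n)|}{|V_n|^{|V'|}}=\beta_{G'} .$$ For a forest $G'$ that is the disjoint union of rooted trees $G_1',\dots,G_r'$, put $\beta_{G'}=\beta_{G_1'}\cdots\beta_{G_r'}$. Let $\mu$ be a compactly supported probability measure on $\mathbb{R}$. Then: 1. for every $k\ge 0$, $\displaystyle\lim_{n\to\infty}m_k\bigl(\boxplus_{G_n}(\mu^{\uplus 1/|V_n|})\bigr)=\sum_{\pi\in\mathcal{NC}_k}\beta_{\mathrm{F}(\pi)}\,\kappa_\pi(\mu)$; 2. $\operatorname{rad}\bigl(\boxplus_{G_n}(\mu^{\uplus 1/|V_n|})\bigr)\le 4\operatorname{rad}(\mu)$ for every $n$; 3. the sequence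 $\boxplus_{G_n}(\mu^{\uplus 1/|V_n|})$ converges weakly to some probability measure on $\mathbb{R}$. -/

import Mathlib

open MeasureTheory Filter Topology
open scoped ENNReal TensorProduct InnerProductSpace CompactlySupported

noncomputable section

namespace GFree

/-! ### Pointed Hilbert spaces and the `G`-free product -/

/-- A pointed Hilbert space `(H, ξ)`: a complex Hilbert space with a unit vector. -/
structure PointedHilbert where
  carrier : Type
  [instNormed : NormedAddCommGroup carrier]
  [instInner : InnerProductSpace ℂ carrier]
  [instComplete : CompleteSpace carrier]
  vec : carrier
  norm_vec : ‖vec‖ = 1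

attribute [instance] PointedHilbert.instNormed PointedHilbert.instInner
  PointedHilbert.instComplete

/-- The orthogonal complement `H°` of `ℂ ξ` in `H`. -/
abbrev PointedHilbert.perp (H : PointedHilbert) : Submodule ℂ H.carrier :=
  (Submodule.span ℂ {H.vec})ᗮ

/-- A bundled complex inner product space. -/
structure PreHilbert where
  carrier : Type
  [instNormed : NormedAddCommGroup carrier]
  [instInner : InnerProductSpace ℂ carrier]

attribute [instance] PreHilbert.instNormed PreHilbert.instInner

universe u

variable {V : Type u}

/-- The algebraic tensor product `H_{v₀}° ⊗ (H_{v₁}° ⊗ (⋯ ⊗ (H_{vₘ}° ⊗ ℂ)))` attached to the word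
`v₀ v₁ … vₘ`; it is `ℂ` for the empty word. -/
def wordSpace (H : V → PointedHilbert) : List V → PreHilbert
  | [] => ⟨ℂ⟩
  | v :: p => ⟨(H v).perp ⊗[ℂ] (wordSpace H p).carrier⟩

/-- The inner product space attached to a word. -/
abbrev Word (H : V → PointedHilbert) (p : List V) : Type := (wordSpace H p).carrier

/-- A word `v₀ v₁ … vₘ` is a reverse path of `G` if there are edges from `v₁` to `v₀`, from `v₂` to
`v₁`, and so on. The empty word is included. -/
def IsRevPath (G : Digraph V) (p : List V) : Prop := p.IsChain (fun v w => G.Adj w v)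

/-- The type of reverse paths of `G`, including the empty one. -/
abbrev RevPath (G : Digraph V) : Type u := {p : List V // IsRevPath G p}

/-- The reverse paths that may be extended on the left by `v`: the empty one and those whose
first vertex `v₀` has an edge to `v`. -/
abbrev ExtPath (G : Digraph V) (v : V) : Type u := {p : List V // IsRevPath G (v :: p)}

/-- The inner product space whose completion is the `G`-free product. -/
abbrev PreProd (G : Digraph V) (H : V → PointedHilbert) : Type u :=
  lp (fun p : RevPath G => Word H p.1) 2

/-- The `G`-free product Hilbert space
`ℂ ξ ⊕ ⨁_{(v₀,…,vₘ)} H_{v₀}° ⊗ ⋯ ⊗ H_{vₘ}°`, the sum being over reverse paths of `G`, as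
the completion of the `ℓ²` direct sum of the algebraic tensor products. -/
abbrev FreeProd (G : Digraph V) (H : V → PointedHilbert) : Type u :=
  UniformSpace.Completion (PreProd G H)

open scoped Classical in
/-- The inclusion of a summand into the `G`-free product. -/
def summand (G : Digraph V) (H : V → PointedHilbert) (p : List V) (hp : IsRevPath G p) :
    Word H p →L[ℂ] FreeProd G H :=
  UniformSpace.Completion.toComplL ∘L
    lp.singleContinuousLinearMap ℂ (fun p : RevPath G => Word H p.1) 2 ⟨p, hp⟩

theorem isRevPath_nil (G : Digraph V) : IsRevPath G [] := List.IsChain.nil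

/-- The vacuum vector `ξ` of the `G`-free product. -/
def vacuum (G : Digraph V) (H : V → PointedHilbert) : FreeProd G H :=
  summand G H [] (isRevPath_nil G) (1 : ℂ)

theorem inner_summand_same (G : Digraph V) (H : V → PointedHilbert) (p : List V)
    (hp : IsRevPath G p) (x y : Word H p) :
    ⟪summand G H p hp x, summand G H p hp y⟫_ℂ = ⟪x, y⟫_ℂ := by
  classical
  simp only [summand, ContinuousLinearMap.comp_apply, UniformSpace.Completion.coe_toComplL,
    UniformSpace.Completion.inner_coe, lp.singleContinuousLinearMap_apply]
  rw [lp.inner_single_left]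
  congr 1
  exact lp.single_apply_self _ _ _

theorem inner_summand_ne (G : Digraph V) (H : V → PointedHilbert) (p q : List V)
    (hp : IsRevPath G p) (hq : IsRevPath G q) (hpq : p ≠ q) (x : Word H p) (y : Word H q) :
    ⟪summand G H p hp x, summand G H q hq y⟫_ℂ = 0 := by
  classical
  simp only [summand, ContinuousLinearMap.comp_apply, UniformSpace.Completion.coe_toComplL,
    UniformSpace.Completion.inner_coe, lp.singleContinuousLinearMap_apply]
  rw [lp.inner_single_left, lp.single_apply_ne, inner_zero_right]
  intro h
  exact hpq (congrArg Subtype.val h)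

theorem norm_vacuum (G : Digraph V) (H : V → PointedHilbert) : ‖vacuum G H‖ = 1 := by
  have h := inner_summand_same G H [] (isRevPath_nil G) (1 : ℂ) (1 : ℂ)
  have h1 : ⟪vacuum G H, vacuum G H⟫_ℂ = 1 := h.trans (by
    change ⟪(1 : ℂ), (1 : ℂ)⟫_ℂ = 1
    simp)
  rw [inner_self_eq_norm_sq_to_K] at h1
  have h2 : ‖vacuum G H‖ ^ 2 = 1 := Complex.ofReal_injective (by simpa using h1)
  nlinarith [norm_nonneg (vacuum G H)]

/-- `⟨ξ_v, ·⟩ ⊗ 1 : H_v ⊗ K → ℂ ⊗ K = K`. -/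
def vacPart (H : PointedHilbert) (K : Type) [NormedAddCommGroup K] [InnerProductSpace ℂ K] :
    H.carrier ⊗[ℂ] K →L[ℂ] K :=
  (TensorProduct.lidIsometry ℂ K).toContinuousLinearEquiv.toContinuousLinearMap ∘L
    (innerSL ℂ H.vec).rTensor K

/-- `Q ⊗ 1 : H_v ⊗ W_p → H_v° ⊗ W_p = W_{v p}`, where `Q` is the orthogonal projection onto
`H_v°`. -/
def perpPart (H : V → PointedHilbert) (v : V) (p : List V) :
    (H v).carrier ⊗[ℂ] Word H p →L[ℂ] Word H (v :: p) :=
  (H v).perp.orthogonalProjectionOnto.rTensor (Word H p)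

theorem inner_split (H : PointedHilbert) (a b : H.carrier) :
    ⟪(⟪H.vec, a⟫_ℂ : ℂ), ⟪H.vec, b⟫_ℂ⟫_ℂ +
      ⟪H.perp.orthogonalProjectionOnto a, H.perp.orthogonalProjectionOnto b⟫_ℂ = ⟪a, b⟫_ℂ := by
  have h : (H.perp.orthogonalProjectionOnto b : H.carrier) = b - ⟪H.vec, b⟫_ℂ • H.vec := by
    have h1 := Submodule.starProjection_orthogonal_val (K := Submodule.span ℂ {H.vec}) b
    rw [Submodule.starProjection_unit_singleton ℂ H.norm_vec] at h1
    exact h1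
  rw [Submodule.inner_orthogonalProjectionOnto_eq_of_mem_right, h, inner_sub_right,
    inner_smul_right, RCLike.inner_apply, inner_conj_symm]
  ring

theorem inner_parts (H : V → PointedHilbert) (v : V) (p : List V)
    (x y : (H v).carrier ⊗[ℂ] Word H p) :
    ⟪vacPart (H v) (Word H p) x, vacPart (H v) (Word H p) y⟫_ℂ +
      ⟪perpPart H v p x, perpPart H v p y⟫_ℂ = ⟪x, y⟫_ℂ := by
  induction x using TensorProduct.induction_on with
  | zero => simp
  | add x₁ x₂ h₁ h₂ =>
    rw [map_add, map_add, inner_add_left, inner_add_left, inner_add_left, ← h₁, ← h₂]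
    ring
  | tmul a k =>
    induction y using TensorProduct.induction_on with
    | zero => simp
    | add y₁ y₂ h₁ h₂ =>
      rw [map_add, map_add, inner_add_right, inner_add_right, inner_add_right, ← h₁, ← h₂]
      ring
    | tmul b l =>
      have h1 : ∀ (a : (H v).carrier) (k : Word H p),
          vacPart (H v) (Word H p) (a ⊗ₜ k) = ⟪(H v).vec, a⟫_ℂ • k := fun _ _ => rfl
      have h2 : ⟪perpPart H v p (a ⊗ₜ k), perpPart H v p (b ⊗ₜ l)⟫_ℂ =
          ⟪(H v).perp.orthogonalProjectionOnto a, (H v).perp.orthogonalProjectionOnto b⟫_ℂ *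
            ⟪k, l⟫_ℂ :=
        TensorProduct.inner_tmul ℂ _ _ _ _
      rw [h1, h1, h2, TensorProduct.inner_tmul, ← inner_split (H v) a b, inner_smul_left,
        inner_smul_right, RCLike.inner_apply]
      ring

theorem IsRevPath.tail {G : Digraph V} {v : V} {p : List V} (h : IsRevPath G (v :: p)) :
    IsRevPath G p := List.IsChain.tail h

/-- For a reverse path `s` that may be extended by `v`, the map
`H_v ⊗ W_s = W_s ⊕ (H_v° ⊗ W_s) → H` onto the sum of the summands of `s` and of `v s`. -/
def extMap (G : Digraph V) (H : V → PointedHilbert) (v : V) (s : ExtPath G v) :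
    (H v).carrier ⊗[ℂ] Word H s.1 →L[ℂ] FreeProd G H :=
  summand G H s.1 s.2.tail ∘L vacPart (H v) (Word H s.1)
    + summand G H (v :: s.1) s.2 ∘L perpPart H v s.1

theorem inner_extMap_same (G : Digraph V) (H : V → PointedHilbert) (v : V) (s : ExtPath G v)
    (x y : (H v).carrier ⊗[ℂ] Word H s.1) :
    ⟪extMap G H v s x, extMap G H v s y⟫_ℂ = ⟪x, y⟫_ℂ := by
  have hne : s.1 ≠ v :: s.1 := fun h => by simpa using congrArg List.length h
  rw [← inner_parts]
  simp only [extMap, add_apply, ContinuousLinearMap.comp_apply, inner_add_left,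
    inner_add_right]
  rw [inner_summand_same, inner_summand_ne G H _ _ _ _ hne, inner_summand_ne G H _ _ _ _ hne.symm,
    inner_summand_same]
  simp

/-- `extMap` as a linear isometry. -/
def extIso (G : Digraph V) (H : V → PointedHilbert) (v : V) (s : ExtPath G v) :
    (H v).carrier ⊗[ℂ] Word H s.1 →ₗᵢ[ℂ] FreeProd G H :=
  (extMap G H v s).toLinearMap.isometryOfInner (inner_extMap_same G H v s)

/-- As `G` has no loops, the summands attached to different extendable paths are orthogonal. -/
theorem orthogonal_extIso (G : Digraph V) [Std.Irrefl G.Adj] (H : V → PointedHilbert) (v : V) :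
    OrthogonalFamily ℂ (fun s : ExtPath G v => (H v).carrier ⊗[ℂ] Word H s.1)
      (extIso G H v) := by
  have key : ∀ s t : ExtPath G v, s.1 ≠ v :: t.1 := by
    intro s t h
    have h1 := s.2
    rw [h] at h1
    have h2 : G.Adj v v := by
      unfold IsRevPath at h1
      simp only [List.isChain_cons_cons] at h1
      exact h1.1
    exact Std.Irrefl.irrefl v h2
  intro s t hst x y
  have h1 : s.1 ≠ t.1 := fun h => hst (Subtype.ext h)
  change ⟪extMap G H v s x, extMap G H v t y⟫_ℂ = 0
  simp only [extMap, add_apply, ContinuousLinearMap.comp_apply, inner_add_left,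
    inner_add_right]
  rw [inner_summand_ne G H _ _ _ _ h1, inner_summand_ne G H _ _ _ _ (key s t),
    inner_summand_ne G H _ _ _ _ (key t s).symm,
    inner_summand_ne G H _ _ _ _ (fun h => h1 (List.cons_injective h))]
  simp

/-- The inner product space `⨁_s H_v ⊗ W_s` over the reverse paths `s` that may be extended by
`v`, whose completion is the Hilbert space `H_v ⊗ H_{⇝ v}`. -/
abbrev PreExt (G : Digraph V) (H : V → PointedHilbert) (v : V) : Type u :=
  lp (fun s : ExtPath G v => (H v).carrier ⊗[ℂ] Word H s.1) 2

/-- The isometric inclusion of `H_v ⊗ H_{⇝ v}` into the `G`-free product; its range is the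
orthogonal complement of `H_{⊥ v}`. -/
def incl (G : Digraph V) [Std.Irrefl G.Adj] (H : V → PointedHilbert) (v : V) :
    UniformSpace.Completion (PreExt G H v) →L[ℂ] FreeProd G H :=
  (orthogonal_extIso G H v).linearIsometry.toContinuousLinearMap.fromCompletion

/-- The operator `a ⊗ 1` on `H_v ⊗ H_{⇝ v}`. -/
def ampl (G : Digraph V) (H : V → PointedHilbert) (v : V)
    (a : (H v).carrier →L[ℂ] (H v).carrier) :
    UniformSpace.Completion (PreExt G H v) →L[ℂ] UniformSpace.Completion (PreExt G H v) :=
  (lp.mapCLM 2 (fun s : ExtPath G v => a.rTensor (Word H s.1)) (norm_nonneg a)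
    (fun _ => ContinuousLinearMap.norm_rTensor_le _ a)).completion

/-- The map `ι_v : B(H_v) → B(H)`, where `ι_v(a)` is `a ⊗ 1` on `H_v ⊗ H_{⇝ v}` and `0` on the
orthogonal complement `H_{⊥ v}`. -/
def iota (G : Digraph V) [Std.Irrefl G.Adj] (H : V → PointedHilbert) (v : V)
    (a : (H v).carrier →L[ℂ] (H v).carrier) : FreeProd G H →L[ℂ] FreeProd G H :=
  incl G H v ∘L ampl G H v a ∘L ContinuousLinearMap.adjoint (incl G H v)

theorem isSelfAdjoint_ampl (G : Digraph V) (H : V → PointedHilbert) (v : V)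
    (a : (H v).carrier →L[ℂ] (H v).carrier) (ha : IsSelfAdjoint a) :
    IsSelfAdjoint (ampl G H v a) := by
  have hT : ∀ (s : ExtPath G v) (x y : (H v).carrier ⊗[ℂ] Word H s.1),
      ⟪a.rTensor (Word H s.1) x, y⟫_ℂ = ⟪x, a.rTensor (Word H s.1) y⟫_ℂ := by
    intro s x y
    induction x using TensorProduct.induction_on with
    | zero => simp
    | add x₁ x₂ h₁ h₂ => rw [map_add, inner_add_left, inner_add_left, h₁, h₂]
    | tmul b k =>
      induction y using TensorProduct.induction_on with
      | zero => simp
      | add y₁ y₂ h₁ h₂ => rw [map_add, inner_add_right, inner_add_right, h₁, h₂]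
      | tmul c l =>
        rw [ContinuousLinearMap.rTensor_tmul, ContinuousLinearMap.rTensor_tmul,
          TensorProduct.inner_tmul, TensorProduct.inner_tmul]
        congr 1
        exact ContinuousLinearMap.isSelfAdjoint_iff_isSymmetric.1 ha b c
  rw [ContinuousLinearMap.isSelfAdjoint_iff_isSymmetric]
  intro x y
  change ⟪ampl G H v a x, y⟫_ℂ = ⟪x, ampl G H v a y⟫_ℂ
  induction x, y using UniformSpace.Completion.induction_on₂ with
  | hp =>
    exact isClosed_eq (by fun_prop) (by fun_prop)
  | ih x y =>
    simp only [ampl, ContinuousLinearMap.completion_apply_coe, UniformSpace.Completion.inner_coe]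
    rw [lp.inner_eq_tsum, lp.inner_eq_tsum]
    exact tsum_congr fun s => hT s (x s) (y s)

theorem isSelfAdjoint_iota (G : Digraph V) [Std.Irrefl G.Adj] (H : V → PointedHilbert) (v : V)
    (a : (H v).carrier →L[ℂ] (H v).carrier) (ha : IsSelfAdjoint a) :
    IsSelfAdjoint (iota G H v a) :=
  (isSelfAdjoint_ampl G H v a ha).conj_adjoint (incl G H v)

/-! ### Spectral distributions -/

section Spectral

variable {E : Type u} [NormedAddCommGroup E] [InnerProductSpace ℂ E] [CompleteSpace E]

/-- The positive linear functional `f ↦ ⟨ξ, f(T) ξ⟩` on the continuous functions on the spectrum of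
a self-adjoint operator `T`. -/
def vectorState (T : E →L[ℂ] E) (hT : IsSelfAdjoint T) (ξ : E) :
    C_c(spectrum ℝ T, ℝ) →ₚ[ℝ] ℝ :=
  PositiveLinearMap.mk₀
    { toFun := fun f => (⟪ξ, cfcHom hT f.toContinuousMap ξ⟫_ℂ).re
      map_add' := by
        intro f g
        have h : (f + g).toContinuousMap = f.toContinuousMap + g.toContinuousMap := rfl
        simp [h]
      map_smul' := by
        intro c f
        have h : (c • f).toContinuousMap = c • f.toContinuousMap := rfl
        simp [h, map_smul, inner_smul_right_eq_smul] }
    (by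
      intro f hf
      have h : 0 ≤ cfcHom hT f.toContinuousMap := cfcHom_nonneg_iff hT |>.2 fun x => hf x
      exact ((ContinuousLinearMap.nonneg_iff_isPositive _).1 h).re_inner_nonneg_right ξ)

/-- The spectral distribution of a self-adjoint bounded operator `T` with respect to the vector state
of `ξ`: the Borel measure on `ℝ`, carried by the spectrum of `T`, whose integral against a
continuous function `f` is `⟨ξ, f(T) ξ⟩`. -/
def spectralMeasure (T : E →L[ℂ] E) (hT : IsSelfAdjoint T) (ξ : E) : Measure ℝ :=
  (RealRMK.rieszMeasure (vectorState T hT ξ)).map Subtype.val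

theorem isProbabilityMeasure_spectralMeasure (T : E →L[ℂ] E) (hT : IsSelfAdjoint T) (ξ : E)
    (hξ : ‖ξ‖ = 1) : IsProbabilityMeasure (spectralMeasure T hT ξ) := by
  let one : C_c(spectrum ℝ T, ℝ) := ⟨1, HasCompactSupport.of_compactSpace _⟩
  have h := RealRMK.integral_rieszMeasure (vectorState T hT ξ) one
  have h1 : vectorState T hT ξ one = 1 := by
    change (⟪ξ, cfcHom hT (1 : C(spectrum ℝ T, ℝ)) ξ⟫_ℂ).re = 1
    simp [inner_self_eq_norm_sq_to_K, hξ]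
  have h2 : (RealRMK.rieszMeasure (vectorState T hT ξ)).real Set.univ = 1 := by
    rw [h1] at h
    simpa [one] using h
  have h3 : IsProbabilityMeasure (RealRMK.rieszMeasure (vectorState T hT ξ)) := by
    constructor
    rw [measureReal_def] at h2
    exact (ENNReal.toReal_eq_one_iff _).1 h2
  exact Measure.isProbabilityMeasure_map measurable_subtype_coe.aemeasurable

/-- The spectral distribution with respect to a unit vector, as a probability measure. -/
def spectralDistribution (T : E →L[ℂ] E) (hT : IsSelfAdjoint T) (ξ : E) (hξ : ‖ξ‖ = 1) :
    ProbabilityMeasure ℝ :=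
  ⟨spectralMeasure T hT ξ, isProbabilityMeasure_spectralMeasure T hT ξ hξ⟩

end Spectral

/-! ### Measures on the line -/

/-- A measure on `ℝ` is compactly supported. -/
def IsCompactlySupported (μ : ProbabilityMeasure ℝ) : Prop :=
  IsCompact (μ : Measure ℝ).support

/-- The support radius `rad(μ)`: the supremum of `|x|` over `x` in the support of `μ`. -/
def rad (μ : ProbabilityMeasure ℝ) : ℝ≥0∞ := ⨆ x ∈ (μ : Measure ℝ).support, ‖x‖ₑ

/-- The `k`-th moment. -/
def moment (μ : ProbabilityMeasure ℝ) (k : ℕ) : ℝ := ∫ x, x ^ k ∂(μ : Measure ℝ)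

/-- The pointed Hilbert space `(L²(ℝ, μ), 1)`. -/
def ltwo (μ : ProbabilityMeasure ℝ) : PointedHilbert where
  carrier := Lp ℂ 2 (μ : Measure ℝ)
  vec := Lp.const 2 (μ : Measure ℝ) (1 : ℂ)
  norm_vec := by
    have h : ‖Lp.const 2 (μ : Measure ℝ) (1 : ℂ)‖ = 1 := by
      rw [Lp.norm_const' 2 (μ : Measure ℝ) (1 : ℂ) (by simp) (by simp)]
      simp
    exact h

open scoped Classical in
/-- The operator of multiplication by the coordinate `x` on `L²(ℝ, μ)`, when `x` is essentially
bounded (in particular when `μ` is compactly supported); by convention `0` otherwise. It is a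
bounded self-adjoint operator with spectral distribution `μ` at the vector `1`. -/
def coordOp (μ : ProbabilityMeasure ℝ) : (ltwo μ).carrier →L[ℂ] (ltwo μ).carrier :=
  if h : MemLp (fun x : ℝ => (x : ℂ)) ∞ (μ : Measure ℝ) then
    LinearMap.mkContinuous
      { toFun := fun f : Lp ℂ 2 (μ : Measure ℝ) => (h.toLp • f : Lp ℂ 2 (μ : Measure ℝ))
        map_add' := fun f g => Lp.add_smul _ f g
        map_smul' := fun c f => (Lp.smul_comm c _ f).symm }
      ‖h.toLp‖ (fun f => Lp.norm_smul_le _ f)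
  else 0

theorem isSelfAdjoint_coordOp (μ : ProbabilityMeasure ℝ) : IsSelfAdjoint (coordOp μ) := by
  rw [coordOp]
  split_ifs with h
  · rw [ContinuousLinearMap.isSelfAdjoint_iff_isSymmetric]
    intro f g
    change ⟪(h.toLp • (show Lp ℂ 2 (μ : Measure ℝ) from f) : Lp ℂ 2 (μ : Measure ℝ)),
        (show Lp ℂ 2 (μ : Measure ℝ) from g)⟫_ℂ =
      ⟪(show Lp ℂ 2 (μ : Measure ℝ) from f),
        (h.toLp • (show Lp ℂ 2 (μ : Measure ℝ) from g) : Lp ℂ 2 (μ : Measure ℝ))⟫_ℂ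
    rw [L2.inner_def, L2.inner_def]
    refine integral_congr_ae ?_
    filter_upwards [Lp.coeFn_lpSMul (r := 2) h.toLp (show Lp ℂ 2 (μ : Measure ℝ) from f),
      Lp.coeFn_lpSMul (r := 2) h.toLp (show Lp ℂ 2 (μ : Measure ℝ) from g), h.coeFn_toLp]
      with x h1 h2 h3
    rw [h1, h2]
    simp only [Pi.smul_apply', h3, smul_eq_mul, RCLike.inner_apply, map_mul, Complex.conj_ofReal]
    ring
  · exact IsSelfAdjoint.zero _

/-- The `G`-free convolution `⊞_G((μ_v)_v)` of compactly supported measures: the spectral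
distribution of `∑_v ι_v(x_v)` at the vacuum vector of the `G`-free product of the spaces
`(L²(ℝ, μ_v), 1)`, where `x_v` is multiplication by the coordinate. -/
def freeConv [Fintype V] (G : Digraph V) [Std.Irrefl G.Adj] (μ : V → ProbabilityMeasure ℝ) :
    ProbabilityMeasure ℝ :=
  spectralDistribution
    (∑ v, iota G (fun v => ltwo (μ v)) v (coordOp (μ v)))
    (isSelfAdjoint_sum _ fun v _ => isSelfAdjoint_iota G _ v _ (isSelfAdjoint_coordOp (μ v)))
    (vacuum G (fun v => ltwo (μ v))) (norm_vacuum G _)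

/-- `⊞_G(μ)`, the `G`-free convolution of copies of the same measure. -/
def freeConvPow [Fintype V] (G : Digraph V) [Std.Irrefl G.Adj] (μ : ProbabilityMeasure ℝ) :
    ProbabilityMeasure ℝ := freeConv G fun _ => μ

/-! ### Partitions and boolean cumulants -/

/-- Partitions of a set of `k` elements, `{0, …, k - 1}` with its usual order. -/
abbrev Part (k : ℕ) : Type := Finpartition (Finset.univ : Finset (Fin k))

/-- Every block is an interval. -/
def IsInterval {k : ℕ} (π : Part k) : Prop := ∀ B ∈ π.parts, ∃ i j, B = Finset.Icc i j

/-- There are no `i < i' < j < j'` with `i, j` in a block and `i', j'` in a different block. -/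
def IsNonCrossing {k : ℕ} (π : Part k) : Prop :=
  ∀ B ∈ π.parts, ∀ B' ∈ π.parts, B ≠ B' → ∀ i i' j j' : Fin k, i < i' → i' < j → j < j' →
    ¬ (i ∈ B ∧ j ∈ B ∧ i' ∈ B' ∧ j' ∈ B')

open scoped Classical in
/-- The interval partitions. -/
def intervalPart (k : ℕ) : Finset (Part k) := Finset.univ.filter IsInterval

open scoped Classical in
/-- The non-crossing partitions. -/
def nonCrossingPart (k : ℕ) : Finset (Part k) := Finset.univ.filter IsNonCrossing

/-- The `k`-th boolean cumulant (`k ≥ 1`),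
`κ_k(μ) = ∑_{π interval} (-1)^{|π| - 1} ∏_{B ∈ π} m_{|B|}(μ)`. -/
def boolCumulant (μ : ProbabilityMeasure ℝ) (k : ℕ) : ℝ :=
  ∑ π ∈ intervalPart k, (-1 : ℝ) ^ (π.parts.card - 1) * ∏ B ∈ π.parts, moment μ B.card

/-- `ν` is the boolean convolution power `μ^{⊎ t}` of the compactly supported measure `μ`: it is
compactly supported and its boolean cumulants are `t` times those of `μ`. There is at most one
such measure, as a compactly supported measure is determined by its moments, hence by its boolean
cumulants. -/
def IsBoolPow (μ : ProbabilityMeasure ℝ) (t : ℝ) (ν : ProbabilityMeasure ℝ) : Prop :=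
  IsCompactlySupported ν ∧ ∀ k, 1 ≤ k → boolCumulant ν k = t * boolCumulant μ k

open scoped Classical in
/-- The boolean convolution power `μ^{⊎ t}` for compactly supported `μ` and `t > 0`. (It exists
for all such `μ` and `t`; the second case is only a convention for other arguments.) -/
def boolPow (μ : ProbabilityMeasure ℝ) (t : ℝ) : ProbabilityMeasure ℝ :=
  if h : ∃ ν, IsBoolPow μ t ν then h.choose else μ

/-! ### Digraphs, trees and forests -/

/-- A list of vertices is a directed path from `u` to `w`. -/
def IsDirectedPath {W : Type*} (T : Digraph W) (u w : W) (l : List W) : Prop :=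
  l.IsChain T.Adj ∧ l.head? = some u ∧ l.getLast? = some w

/-- A rooted tree: from some vertex there is a unique directed path to each vertex. -/
def IsRootedTree {W : Type*} (T : Digraph W) : Prop :=
  ∃ r, ∀ w, ∃! l, IsDirectedPath T r w l

/-- The set `Hom(T, G)` of digraph homomorphisms. -/
abbrev DigraphHom {W : Type*} {V : Type*} (T : Digraph W) (G : Digraph V) : Type _ :=
  T.Adj →r G.Adj

/-- The digraph induced on a set of vertices. -/
def induced {W : Type*} (F : Digraph W) (s : Set W) : Digraph s := ⟨fun a b => F.Adj a b⟩

/-- The extension of coefficients `β` from rooted trees to forests: the product over the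
(weakly) connected components of the forest. -/
def forestCoeff (β : (W : Type) → Digraph W → ℝ) {W : Type} (F : Digraph W) : ℝ :=
  ∏ᶠ c : F.toSimpleGraphInclusive.ConnectedComponent, β c.supp (induced F c.supp)

/-- `B ≺ B'`: the block `B'` is nested inside `B`, between two consecutive elements of `B`. -/
def Nested {k : ℕ} (B B' : Finset (Fin k)) : Prop :=
  ∃ i ∈ B, ∃ j ∈ B, i < j ∧ B' ⊆ Finset.Ioo i j ∧ Disjoint (Finset.Ioo i j) B

/-- The nesting forest `F(π)`: its vertices are the blocks and its edges are given by the
covering relation of `≺`. -/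
def nestingForest {k : ℕ} (π : Part k) : Digraph π.parts :=
  ⟨fun B B' => Nested B.1 B'.1 ∧ ¬ ∃ B'' : π.parts, Nested B.1 B''.1 ∧ Nested B''.1 B'.1⟩

end GFree

end

open GFree

noncomputable section

namespace GFree

/-! ### Blocks of a partition -/

section Blocks

variable {k : ℕ} (π : Part k)

/-! The vacuum moments of the sum of all `ι_v(a)` are expanded exactly, for each fixed digraph; the
limit is then read off term by term.

Let Q be the projection onto the complement of ξ in one leg, and κ_j = ⟨ξ, a(Qa)^{j-1}ξ⟩. Every
vector reached from the vacuum is a combination of elementary tensors whose factors are (Qa)^{j+1}ξ,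
one for each pair (v, j) on a stack. Applying `ι_v(a)` creates a new factor if v is a successor of
the top label, applies `a` to the top factor if its label is v, and gives 0 otherwise. The resulting
factor splits into its Q-part, which stays, and its ξ-part, which removes the entry at the price of
some κ_j (`iota_stackVec`). A word leading from the empty stack to itself is thus a sequence of
labels with marks for opening and closing. If its weight is nonzero, the marks are those of exactly
one non-crossing partition π (`exists_part_of_runWeight_ne_zero`, `kind_injOn`), and the admissible
labels are the homomorphisms from the nesting forest (`labelEquiv`). Hence the k-th moment of ⊞_G(ν)
is ∑_π |Hom(F(π), G)| κ_π(ν) (`moment_freeConvPow`). Here the κ_j are the boolean cumulants of ν,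
because both families satisfy the same moment recursion (`boolCumulant_eq_opCumulant`).

For ν = μ^{⊎1/N} with N = |V|, the factor N^{-|π|} turns |Hom| into a homomorphism density.
Densities of forests factor over their tree components, so they converge (`tendsto_forestCoeff`).

The densities are at most 1, |κ_j(μ)| ≤ rad(μ)^j, and there are at most 4^k non-crossing partitions,
so the k-th moment is at most (4 rad(μ))^k in absolute value. This bounds the support
(`rad_le_of_abs_moment_le`). Convergent moments on a common compact interval give weak convergence
(`exists_tendsto_of_tendsto_moment`). -/

theorem mem_part_refl (i : Fin k) : i ∈ π.part i := by simp

theorem part_mem_parts (i : Fin k) : π.part i ∈ π.parts := by simp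

theorem mem_part_iff {i j : Fin k} : j ∈ π.part i ↔ π.part j = π.part i :=
  π.mem_part_iff_part_eq_part (Finset.mem_univ _) (Finset.mem_univ _)

/-- The smallest element of the block of `i`. -/
def blockMin (i : Fin k) : Fin k := (π.part i).min' ⟨i, mem_part_refl π i⟩

/-- The largest element of the block of `i`. -/
def blockMax (i : Fin k) : Fin k := (π.part i).max' ⟨i, mem_part_refl π i⟩

theorem blockMin_mem (i : Fin k) : blockMin π i ∈ π.part i := Finset.min'_mem _ _

theorem blockMax_mem (i : Fin k) : blockMax π i ∈ π.part i := Finset.max'_mem _ _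

theorem part_blockMin (i : Fin k) : π.part (blockMin π i) = π.part i :=
  (mem_part_iff π).1 (blockMin_mem π i)

theorem part_blockMax (i : Fin k) : π.part (blockMax π i) = π.part i :=
  (mem_part_iff π).1 (blockMax_mem π i)

variable {π}

theorem blockMin_le {i j : Fin k} (h : π.part i = π.part j) : blockMin π i ≤ j :=
  Finset.min'_le _ _ (h ▸ mem_part_refl π j)

theorem le_blockMax {i j : Fin k} (h : π.part i = π.part j) : j ≤ blockMax π i :=
  Finset.le_max' _ _ (h ▸ mem_part_refl π j)

theorem blockMin_congr {i j : Fin k} (h : π.part i = π.part j) : blockMin π i = blockMin π j := by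
  simp only [blockMin, h]

theorem blockMax_congr {i j : Fin k} (h : π.part i = π.part j) : blockMax π i = blockMax π j := by
  simp only [blockMax, h]

theorem part_eq_iff_blockMin {i j : Fin k} : π.part i = π.part j ↔ blockMin π i = blockMin π j :=
  ⟨blockMin_congr, fun h => by rw [← part_blockMin π i, h, part_blockMin]⟩

theorem blockMin_blockMin (i : Fin k) : blockMin π (blockMin π i) = blockMin π i :=
  blockMin_congr (part_blockMin π i)

theorem isNonCrossing_iff : IsNonCrossing π ↔ ∀ i i' j j' : Fin k, i < i' → i' < j → j < j' →
    π.part i = π.part j → π.part i' = π.part j' → π.part i = π.part i' := by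
  constructor
  · intro h i i' j j' h1 h2 h3 hij hij'
    by_contra hne
    exact h _ (part_mem_parts π i) _ (part_mem_parts π i') hne i i' j j' h1 h2 h3
      ⟨mem_part_refl π i, hij ▸ mem_part_refl π j, mem_part_refl π i', hij' ▸ mem_part_refl π j'⟩
  · rintro h B hB B' hB' hne i i' j j' h1 h2 h3 ⟨hi, hj, hi', hj'⟩
    have e1 := π.part_eq_of_mem hB hi
    have e2 := π.part_eq_of_mem hB hj
    have e3 := π.part_eq_of_mem hB' hi'
    have e4 := π.part_eq_of_mem hB' hj'
    exact hne (by rw [← e1, ← e3]; exact h i i' j j' h1 h2 h3 (e1.trans e2.symm) (e3.trans e4.symm))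

variable (π)

/-- The minima of the blocks that contain elements before and from `m` on. -/
def openAt (m : ℕ) : Finset (Fin k) :=
  Finset.univ.filter fun i => blockMin π i = i ∧ (i : ℕ) < m ∧ m ≤ blockMax π i

/-- The minima of the other blocks that contain elements before and after `m`. -/
def coverAt (m : Fin k) : Finset (Fin k) :=
  Finset.univ.filter fun i => blockMin π i = i ∧ i < blockMin π m ∧ m ≤ blockMax π i

variable {π}

theorem lt_of_mem_coverAt {m i : Fin k} (h : i ∈ coverAt π m) : i < blockMin π m :=
  (Finset.mem_filter.1 h).2.2.1

theorem part_ne_of_mem_coverAt {m i : Fin k} (h : i ∈ coverAt π m) : π.part i ≠ π.part m := by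
  intro h1
  have h2 := Finset.mem_filter.1 h
  have := blockMin_congr h1
  omega

/-- A block that opens after the block of `m` does, but by position `m`, and is not yet finished
there would cross the block of `m`. So every other block that spans `m` starts before the block of
`m`. -/
theorem open_iff_of_isNonCrossing (hπ : IsNonCrossing π) (m i : Fin k) :
    (blockMin π i = i ∧ i ≤ m ∧ m ≤ blockMax π i) ↔ i = blockMin π m ∨ i ∈ coverAt π m := by
  rw [isNonCrossing_iff] at hπ
  simp only [coverAt, Finset.mem_filter, Finset.mem_univ, true_and]
  constructor
  · rintro ⟨h1, h2, h3⟩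
    by_cases h4 : π.part i = π.part m
    · exact Or.inl (h1.symm.trans (blockMin_congr h4))
    · refine Or.inr ⟨h1, ?_, h3⟩
      by_contra h5
      have h6 : i ≠ m := fun h => h4 (by rw [h])
      have h7 : blockMax π i ≠ m := fun h => h4 (by rw [← part_blockMax, h])
      have h8 : blockMin π m ≠ i := fun h => h4 (by rw [← part_blockMin π m, h])
      have := hπ (blockMin π m) i m (blockMax π i) (by omega) (by omega) (by omega)
        (part_blockMin π m) (part_blockMax π i).symm
      exact h4 (by rw [← this, part_blockMin])
  · rintro (h | ⟨h1, h2, h3⟩)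
    · subst h
      exact ⟨blockMin_blockMin m, blockMin_le rfl, by
        rw [blockMax_congr (part_blockMin π m)]; exact le_blockMax rfl⟩
    · have : blockMin π m ≤ m := blockMin_le rfl
      exact ⟨h1, by omega, h3⟩

variable (π)

/-- The minima of the blocks that are open at `m`, the innermost block first. -/
def openList (m : ℕ) : List (Fin k) := (openAt π m).sort (· ≥ ·)

/-- The minima of the blocks that cover `m`, the innermost block first. -/
def coverList (m : Fin k) : List (Fin k) := (coverAt π m).sort (· ≥ ·)

variable {π}

theorem sortedGT_cons_coverList (m : Fin k) : (blockMin π m :: coverList π m).SortedGT := by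
  rw [List.sortedGT_iff_pairwise, List.pairwise_cons]
  refine ⟨fun i hi => ?_, ((coverAt π m).sortedGT_sort).pairwise⟩
  exact lt_of_mem_coverAt ((Finset.mem_sort _).1 hi)

/-- This is the stack just before the letter `m`. The block of `m` is on top, since the covering
blocks have smaller minima; it is absent exactly when `m` is its first element. -/
theorem openList_eq (hπ : IsNonCrossing π) (m : Fin k) :
    openList π m =
      if blockMin π m = m then coverList π m else blockMin π m :: coverList π m := by
  have key := open_iff_of_isNonCrossing hπ m
  split_ifs with h
  · refine (Finset.sortedGT_sort _).eq_of_mem_iff (Finset.sortedGT_sort _) fun i => ?_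
    rw [Finset.mem_sort, coverList, Finset.mem_sort]
    simp only [openAt, coverAt, Finset.mem_filter, Finset.mem_univ, true_and, h, Fin.lt_def,
      Fin.le_def]
  · refine (Finset.sortedGT_sort _).eq_of_mem_iff (sortedGT_cons_coverList m) fun i => ?_
    rw [Finset.mem_sort, List.mem_cons, coverList, Finset.mem_sort, ← key]
    simp only [openAt, Finset.mem_filter, Finset.mem_univ, true_and, Fin.le_def]
    have : i ≠ m ∨ ¬ blockMin π i = i := by
      by_contra! h1
      exact h (h1.1 ▸ h1.2)
    constructor
    · rintro ⟨h1, h2, h3⟩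
      exact ⟨h1, h2.le, h3⟩
    · rintro ⟨h1, h2, h3⟩
      exact ⟨h1, by have := Fin.val_ne_iff.2 (this.resolve_right (not_not.2 h1)); omega, h3⟩

/-- This is the stack just after the letter `m`: the block of `m` has gone exactly when `m` is its
last element, and the covering blocks are untouched. -/
theorem openList_succ (hπ : IsNonCrossing π) (m : Fin k) :
    openList π (m + 1) =
      if blockMax π m = m then coverList π m else blockMin π m :: coverList π m := by
  have key := open_iff_of_isNonCrossing hπ m
  split_ifs with h
  · refine (Finset.sortedGT_sort _).eq_of_mem_iff (Finset.sortedGT_sort _) fun i => ?_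
    rw [Finset.mem_sort, coverList, Finset.mem_sort]
    constructor
    · intro hi
      simp only [openAt, Finset.mem_filter, Finset.mem_univ, true_and] at hi
      refine ((key i).1 ⟨hi.1, by omega, by omega⟩).resolve_left ?_
      rintro rfl
      rw [blockMax_congr (part_blockMin π m), h] at hi
      omega
    · intro hi
      have h1 := (key i).2 (Or.inr hi)
      have h2 : blockMax π i ≠ m := fun h2 => part_ne_of_mem_coverAt hi (by
        rw [← part_blockMax, h2])
      simp only [openAt, Finset.mem_filter, Finset.mem_univ, true_and]
      exact ⟨h1.1, by omega, by omega⟩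
  · refine (Finset.sortedGT_sort _).eq_of_mem_iff (sortedGT_cons_coverList m) fun i => ?_
    rw [Finset.mem_sort, List.mem_cons, coverList, Finset.mem_sort, ← key]
    simp only [openAt, Finset.mem_filter, Finset.mem_univ, true_and]
    constructor
    · rintro ⟨h1, h2, h3⟩
      exact ⟨h1, by omega, by omega⟩
    · rintro ⟨h1, h2, h3⟩
      have : blockMax π i ≠ m := fun h4 => h (by
        rw [← h4, blockMax_congr (part_blockMax π i)])
      exact ⟨h1, by omega, by omega⟩

theorem openList_zero : openList π 0 = [] := by
  simp [openList, openAt]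

theorem openList_last : openList π k = [] := by
  have : openAt π k = ∅ := by
    refine Finset.filter_eq_empty_iff.2 fun i _ h => ?_
    have := (blockMax π i).2
    omega
  simp [openList, this]

/-! ### Counting the elements of a block read so far -/

variable (π)

/-- The number of elements of the block of `i` strictly between `i` and `m`. -/
def countUpTo (i : Fin k) (m : ℕ) : ℕ :=
  ((π.part i).filter fun j => i < j ∧ (j : ℕ) < m).card

variable {π}

theorem countUpTo_succ_of_ne {i m : Fin k} (h : π.part i ≠ π.part m) :
    countUpTo π i (m + 1) = countUpTo π i m := by
  unfold countUpTo
  congr 1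
  refine Finset.filter_congr fun j hj => ?_
  have : j ≠ m := by
    rintro rfl
    exact h ((mem_part_iff π).1 hj).symm
  have := Fin.val_ne_iff.2 this
  omega

theorem countUpTo_self_succ (m : Fin k) : countUpTo π m (m + 1) = 0 := by
  unfold countUpTo
  rw [Finset.card_eq_zero, Finset.filter_eq_empty_iff]
  intro j _ h
  omega

theorem countUpTo_succ {m : Fin k} (h : blockMin π m ≠ m) :
    countUpTo π (blockMin π m) (m + 1) = countUpTo π (blockMin π m) m + 1 := by
  unfold countUpTo
  have h1 : blockMin π m ≤ m := blockMin_le rfl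
  rw [part_blockMin, ← Finset.card_insert_of_notMem (a := m)]
  · congr 1
    ext j
    simp only [Finset.mem_filter, Finset.mem_insert]
    constructor
    · rintro ⟨h2, h3, h4⟩
      by_cases h5 : j = m
      · exact Or.inl h5
      · exact Or.inr ⟨h2, h3, by have := Fin.val_ne_iff.2 h5; omega⟩
    · rintro (rfl | ⟨h2, h3, h4⟩)
      · exact ⟨mem_part_refl π j, by omega, by omega⟩
      · exact ⟨h2, h3, by omega⟩
  · simp

/-- The first element is the only one that the counter omits, which is why an entry with counter `j`
leaves with weight `c (j + 1)`. -/
theorem countUpTo_blockMax {m : Fin k} (h : blockMax π m = m) :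
    countUpTo π (blockMin π m) (m + 1) + 1 = (π.part m).card := by
  unfold countUpTo
  rw [part_blockMin, ← Finset.card_insert_of_notMem (a := blockMin π m)]
  · congr 1
    ext j
    simp only [Finset.mem_filter, Finset.mem_insert]
    constructor
    · rintro (rfl | ⟨h2, -⟩)
      · exact blockMin_mem π m
      · exact h2
    · intro hj
      have h2 := (mem_part_iff π).1 hj
      have h3 : blockMin π m ≤ j := blockMin_le h2.symm
      have h4 : j ≤ blockMax π m := le_blockMax h2.symm
      by_cases h5 : j = blockMin π m
      · exact Or.inl h5
      · exact Or.inr ⟨hj, by omega, by omega⟩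
  · simp

/-- Each block has exactly one maximum, so weights charged on closing are charged once per block. -/
theorem prod_blockMax {R : Type*} [CommMonoid R] (c : ℕ → R) :
    ∏ m : Fin k, (if blockMax π m = m then c (π.part m).card else 1) =
      ∏ B ∈ π.parts, c B.card := by
  rw [← Finset.prod_filter]
  refine Finset.prod_bij (fun m _ => π.part m) (fun m _ => part_mem_parts π m) ?_ ?_ ?_
  · intro m hm m' hm' h
    rw [Finset.mem_filter] at hm hm'
    rw [← hm.2, ← hm'.2, blockMax_congr h]
  · intro B hB
    obtain ⟨i, hi⟩ := π.nonempty_of_mem_parts hB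
    have h := π.part_eq_of_mem hB hi
    refine ⟨blockMax π i, ?_, by rw [part_blockMax, h]⟩
    simp [blockMax_congr (part_blockMax π i)]
  · intros; rfl

end Blocks

/-! ### Stacks -/

section Machine

variable {V : Type*} {R : Type*} [CommRing R]

/-- A new entry labelled `v` is put on the stack, or the counter of the top entry is increased. -/
def enter : Bool → V → List (V × ℕ) → List (V × ℕ)
  | true, v, s => (v, 0) :: s
  | false, _, (u, j) :: s => (u, j + 1) :: s
  | false, _, [] => []

/-- The top entry is removed from the stack if the argument is `true`. -/
def leave : Bool → List (V × ℕ) → List (V × ℕ)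
  | true, s => s.tail
  | false, s => s

/-- A new entry has to be a successor of the top entry in `G`, and only the label of the top entry
may be used again. -/
def EnterOK (G : Digraph V) : Bool → V → List (V × ℕ) → Prop
  | true, v, s => ∀ p ∈ s.head?, G.Adj p.1 v
  | false, v, s => ∃ p ∈ s.head?, p.1 = v

/-- The weight with which an entry leaves the stack. -/
def leaveWeight (c : ℕ → R) : Bool → List (V × ℕ) → R
  | true, (_, j) :: _ => c (j + 1)
  | _, _ => 1

/-- The effect of a letter on the stack. -/
def stackStep (x : V × Bool × Bool) (s : List (V × ℕ)) : List (V × ℕ) :=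
  leave x.2.2 (enter x.2.1 x.1 s)

open scoped Classical in
/-- The weight of a letter. -/
def stepWeight (G : Digraph V) (c : ℕ → R) (x : V × Bool × Bool) (s : List (V × ℕ)) : R :=
  if EnterOK G x.2.1 x.1 s then leaveWeight c x.2.2 (enter x.2.1 x.1 s) else 0

/-- The total weight of the words of length `n` that lead from the stack `s` to the empty
stack. -/
def runSum [Fintype V] (G : Digraph V) (c : ℕ → R) : ℕ → List (V × ℕ) → R
  | 0, [] => 1
  | 0, _ :: _ => 0
  | n + 1, s => ∑ x : V × Bool × Bool, stepWeight G c x s * runSum G c n (stackStep x s)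

/-- The weight of a word. -/
def runWeight (G : Digraph V) (c : ℕ → R) : (n : ℕ) → (Fin n → V × Bool × Bool) →
    List (V × ℕ) → R
  | 0, _, [] => 1
  | 0, _, _ :: _ => 0
  | n + 1, x, s => stepWeight G c (x 0) s * runWeight G c n (Fin.tail x) (stackStep (x 0) s)

theorem runSum_eq_sum_runWeight [Fintype V] (G : Digraph V) (c : ℕ → R) (n : ℕ)
    (s : List (V × ℕ)) :
    runSum G c n s = ∑ x : Fin n → V × Bool × Bool, runWeight G c n x s := by
  induction n generalizing s with
  | zero =>
    rw [Fintype.sum_unique]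
    cases s <;> rfl
  | succ n ih =>
    rw [← (Fin.consEquiv fun _ => V × Bool × Bool).sum_comp, Fintype.sum_prod_type, runSum]
    refine Finset.sum_congr rfl fun x _ => ?_
    rw [ih, Finset.mul_sum]
    rfl

theorem runWeight_eq_prod (G : Digraph V) (c : ℕ → R) (n : ℕ) (x : Fin n → V × Bool × Bool)
    (st : ℕ → List (V × ℕ)) (h : ∀ i : Fin n, st (i + 1) = stackStep (x i) (st i))
    (hn : st n = []) : runWeight G c n x (st 0) = ∏ i : Fin n, stepWeight G c (x i) (st i) := by
  induction n generalizing st with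
  | zero => simp [hn, runWeight]
  | succ n ih =>
    have h1 := ih (Fin.tail x) (fun m => st (m + 1)) (fun i => h i.succ) hn
    have h2 : st (0 + 1) = stackStep (x 0) (st 0) := h 0
    rw [Fin.prod_univ_succ, runWeight, ← h2, h1]
    rfl

theorem exists_run_of_runWeight_ne_zero (G : Digraph V) (c : ℕ → R) (n : ℕ)
    (x : Fin n → V × Bool × Bool) (s : List (V × ℕ)) (h : runWeight G c n x s ≠ 0) :
    ∃ st : ℕ → List (V × ℕ), st 0 = s ∧ st n = [] ∧ ∀ i : Fin n,
      st (i + 1) = stackStep (x i) (st i) ∧ EnterOK G (x i).2.1 (x i).1 (st i) := by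
  induction n generalizing s with
  | zero =>
    refine ⟨fun _ => s, rfl, ?_, fun i => i.elim0⟩
    cases s with
    | nil => rfl
    | cons a s => exact absurd rfl h
  | succ n ih =>
    rw [runWeight] at h
    obtain ⟨st, h1, h2, h3⟩ := ih _ _ (right_ne_zero_of_mul h)
    have h4 : EnterOK G (x 0).2.1 (x 0).1 s := by
      by_contra h4
      exact left_ne_zero_of_mul h (if_neg h4)
    refine ⟨fun m => m.casesOn s st, rfl, h2, fun i => ?_⟩
    induction i using Fin.cases with
    | zero => exact ⟨h1, h4⟩
    | succ i => exact h3 i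

/-- Opening and closing marks with nonnegative heights form a system of nested brackets. Two letters
belong together when they act on the same stack entry, and brackets of this kind do not cross. -/
theorem exists_part_of_heights {n : ℕ} (a b : Fin n → Bool) (h : ℕ → ℕ) (h0 : h 0 = 0)
    (hn : h n = 0) (hpos : ∀ i : Fin n, 1 ≤ h i + (a i).toNat)
    (hstep : ∀ i : Fin n, h (i + 1) + (b i).toNat = h i + (a i).toNat) :
    ∃ π : Part n, IsNonCrossing π ∧ ∀ i, (blockMin π i = i ↔ a i = true) ∧
      (blockMax π i = i ↔ b i = true) := by
  classical
  let lev : Fin n → ℕ := fun i => h i + (a i).toNat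
  have hlev : ∀ i, lev i = h i + (a i).toNat := fun _ => rfl
  have hbool : ∀ c : Bool, (c = true ∧ c.toNat = 1) ∨ (c = false ∧ c.toNat = 0) := by decide
  -- `lev i` is the height once the letter `i` has entered. The same entry is on top at `i` and `j`
  -- when the levels agree and the height never drops below that level between them.
  let s : Setoid (Fin n) :=
    { r := fun i j => lev i = lev j ∧
        (∀ m, (i : ℕ) < m → m ≤ j → lev i ≤ h m) ∧ (∀ m, (j : ℕ) < m → m ≤ i → lev i ≤ h m)
      iseqv :=
        { refl := fun i => ⟨rfl, fun m h1 h2 => by omega, fun m h1 h2 => by omega⟩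
          symm := fun {i j} ⟨h1, h2, h3⟩ => ⟨h1.symm, h1 ▸ h3, h1 ▸ h2⟩
          trans := fun {i j l} ⟨h1, h2, h3⟩ ⟨h4, h5, h6⟩ => by
            refine ⟨h1.trans h4, fun m h7 h8 => ?_, fun m h7 h8 => ?_⟩
            · by_cases h9 : m ≤ j
              · exact h2 m h7 h9
              · exact h1 ▸ h5 m (by omega) h8
            · by_cases h9 : m ≤ j
              · exact h1 ▸ h6 m h7 h9
              · exact h3 m (by omega) h8 } }
  let π : Part n := Finpartition.ofSetoid s
  have hr : ∀ {i j : Fin n}, π.part i = π.part j ↔ (lev i = lev j ∧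
        (∀ m, (i : ℕ) < m → m ≤ j → lev i ≤ h m) ∧
        (∀ m, (j : ℕ) < m → m ≤ i → lev i ≤ h m)) := by
    intro i j
    rw [eq_comm, ← mem_part_iff]
    exact Finpartition.mem_part_ofSetoid_iff_rel
  refine ⟨π, isNonCrossing_iff.2 fun i i' j j' h1 h2 h3 h4 h5 => ?_, fun i => ⟨?_, ?_⟩⟩
  · rw [hr] at h4 h5 ⊢
    have e1 := h4.2.1 i' (by omega) (by omega)
    have e2 := h4.2.1 j (by omega) (by omega)
    have e3 := h5.2.1 j (by omega) (by omega)
    have e4 := hlev i'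
    have e5 := hlev j
    have e6 : lev j = h j := by
      rcases hbool (a j) with h | h <;> omega
    refine ⟨by omega, fun m h6 h7 => h4.2.1 m h6 (by omega), fun m h6 h7 => by omega⟩
  · have hle : blockMin π i ≤ i := blockMin_le rfl
    constructor
    · intro hi
      by_contra ha
      have ha' := (hbool (a i)).resolve_left fun h => ha h.1
      have h1 := hpos i
      -- The least such `d` finds the last moment up to `i` with the height below `lev i`. The
      -- letter there pushed the entry used at `i`, so it is an earlier element of the same block.
      have hex : ∃ d, d ≤ (i : ℕ) ∧ h (i - d) < lev i := ⟨i, le_rfl, by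
        rw [Nat.sub_self, h0]
        exact h1⟩
      have h2 := Nat.find_spec hex
      have h3 := @Nat.find_min _ _ hex
      set d := Nat.find hex
      have hd : d ≠ 0 := by
        intro hd
        rw [hd] at h2
        have := hlev i
        simp only [Nat.sub_zero] at h2
        omega
      have h4 : ∀ m, (i : ℕ) - d < m → m ≤ i → lev i ≤ h m := by
        intro m h5 h6
        have := @h3 (i - m) (by omega)
        have e : (i : ℕ) - (i - m) = m := by omega
        rw [e] at this
        by_contra h7
        exact this ⟨by omega, by omega⟩
      let j : Fin n := ⟨i - d, by omega⟩
      have h5 : lev i ≤ h (j + 1) := h4 _ (by simp only [j]; omega) (by simp only [j]; omega)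
      have h6 := hstep j
      have h7 : h j < lev i := h2.2
      have h8 := hlev j
      have h9 := hbool (a j)
      have h10 : π.part i = π.part j := hr.2 ⟨by omega, fun m h11 h12 => by
        simp only [j] at h12; omega, h4⟩
      have h11 : blockMin π i ≤ j := blockMin_le h10
      have h12 : (j : ℕ) < i := by simp only [j]; omega
      omega
    · intro ha
      refine le_antisymm hle ?_
      by_contra hlt
      have h1 := hr.1 (part_blockMin π i)
      have h2 := h1.2.1 i (by omega) le_rfl
      have h3 := hlev i
      have h4 := hbool (a i)
      rw [ha] at h4
      simp at h4
      rw [ha] at h3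
      simp at h3
      omega
  · have hle : i ≤ blockMax π i := le_blockMax rfl
    constructor
    · intro hi
      by_contra hb
      have hb' := (hbool (b i)).resolve_left fun h => hb h.1
      -- The first later moment with the height below `lev i` comes right after the letter that
      -- removes the entry, so that letter is a later element of the same block.
      have hex : ∃ m, (i : ℕ) < m ∧ h m < lev i := ⟨n, i.2, by
        have := hpos i
        rw [hn]; exact this⟩
      have h2 := Nat.find_spec hex
      have h3 := @Nat.find_min _ _ hex
      have h3' := Nat.find_min' hex (m := n) ⟨i.2, by
        have := hpos i
        rw [hn]; exact this⟩
      set m := Nat.find hex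
      have h4 := hstep i
      have h5 := hlev i
      have hm : m ≠ i + 1 := by
        intro hm
        rw [hm] at h2
        omega
      let j : Fin n := ⟨m - 1, by omega⟩
      have hj : (j : ℕ) + 1 = m := by simp only [j]; omega
      have h4 : ∀ l, (i : ℕ) < l → l ≤ j → lev i ≤ h l := by
        intro l h6 h7
        have := @h3 l (by omega)
        by_contra h8
        exact this ⟨by omega, by omega⟩
      have h6 := hstep j
      rw [hj] at h6
      have h7 := hlev j
      have h8 := h4 j (by omega) le_rfl
      have h9 := hbool (b j)
      have h9' := hbool (a j)
      have h10 : π.part i = π.part j := hr.2 ⟨by omega, h4, fun m h11 h12 => by omega⟩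
      have h11 : j ≤ blockMax π i := le_blockMax h10
      omega
    · intro hb
      refine le_antisymm ?_ hle
      by_contra hlt
      have h1 := hr.1 (part_blockMax π i)
      have h2 := h1.2.2 (i + 1) (by omega) (by omega)
      have h3 := hstep i
      have h4 := hlev i
      have h5 := h1.1
      rw [hb] at h3
      simp at h3
      omega

/-- The heights are the stack lengths. A letter that opens nothing needs a nonempty stack, so the
height after entering is always at least 1. -/
theorem exists_part_of_runWeight_ne_zero (G : Digraph V) (c : ℕ → R) (n : ℕ)
    (x : Fin n → V × Bool × Bool) (h : runWeight G c n x [] ≠ 0) :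
    ∃ π : Part n, IsNonCrossing π ∧ ∀ i, (blockMin π i = i ↔ (x i).2.1 = true) ∧
      (blockMax π i = i ↔ (x i).2.2 = true) := by
  obtain ⟨st, h0, hn, hst⟩ := exists_run_of_runWeight_ne_zero G c n x [] h
  have henter : ∀ i, (enter (x i).2.1 (x i).1 (st i)).length =
      (st i).length + ((x i).2.1).toNat ∧ 1 ≤ (enter (x i).2.1 (x i).1 (st i)).length := by
    intro i
    have h1 := (hst i).2
    revert h1
    generalize st i = s
    obtain ⟨v, a, b⟩ := x i
    intro h1
    cases a
    · obtain ⟨p, hp, -⟩ := h1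
      cases s with
      | nil => simp at hp
      | cons q s => simp [enter]
    · simp [enter]
  refine exists_part_of_heights (fun i => (x i).2.1) (fun i => (x i).2.2)
    (fun m => (st m).length) (by simp [h0]) (by simp [hn]) (fun i => ?_) (fun i => ?_)
  · rw [← (henter i).1]
    exact (henter i).2
  · have h1 := henter i
    rw [← h1.1, (hst i).1, stackStep]
    cases (x i).2.2
    · simp [leave]
    · simp only [leave, List.length_tail, Bool.toNat_true]
      omega

end Machine

/-! ### Non-crossing partitions as words -/

section Labels

variable {V : Type*} {R : Type*} [CommRing R] {k : ℕ} {π : Part k}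

open scoped Classical in
/-- The word that marks the first and the last elements of the blocks. -/
def kind (π : Part k) (i : Fin k) : Bool × Bool :=
  (decide (blockMin π i = i), decide (blockMax π i = i))

/-- Reading from left to right, an element that is not the first of its block must join the
innermost block still open. The marks and the part already read determine that block. -/
theorem part_eq_of_kind_eq {π' : Part k} (hπ : IsNonCrossing π) (hπ' : IsNonCrossing π')
    (h : kind π = kind π') (m : ℕ) : ∀ i j : Fin k, i < j → (j : ℕ) < m →
      π.part i = π.part j → π'.part i = π'.part j := by
  have hmin : ∀ i, blockMin π i = i ↔ blockMin π' i = i := fun i => by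
    simpa [kind] using congrArg Prod.fst (congrFun h i)
  have hmax : ∀ i, blockMax π i = i ↔ blockMax π' i = i := fun i => by
    simpa [kind] using congrArg Prod.snd (congrFun h i)
  clear h
  -- The equivalence is the usable induction hypothesis, because `key` is applied in both
  -- directions.
  suffices H : ∀ m : ℕ, ∀ i j : Fin k, i < j → (j : ℕ) < m →
      (π.part i = π.part j ↔ π'.part i = π'.part j) from fun i j h1 h2 => (H m i j h1 h2).1
  clear m
  -- the predecessor of `l` in its block is the last element of an open block
  have key : ∀ (π π' : Part k), IsNonCrossing π → IsNonCrossing π' →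
      (∀ i, blockMax π i = i ↔ blockMax π' i = i) → ∀ l p p' : Fin k,
      (∀ i j : Fin k, i < j → j < l → (π.part i = π.part j ↔ π'.part i = π'.part j)) →
      p < l → π.part p = π.part l → (∀ q, p < q → q < l → π.part q ≠ π.part l) →
      p' < l → π'.part p' = π'.part l → (∀ q, p' < q → q < l → π'.part q ≠ π'.part l) →
      p' ≤ p := by
    intro π π' hπ hπ' hmax l p p' ih hp1 hp2 hp3 hq1 hq2 hq3
    by_contra hlt
    have h1 : blockMax π' p' ≠ p' := by
      have : l ≤ blockMax π' p' := le_blockMax hq2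
      omega
    rw [Ne, ← hmax] at h1
    have h2 : p' ≤ blockMax π p' := le_blockMax rfl
    have h3 := part_blockMax π p'
    -- If `p < p'`, then `p'` is not last in its block of `π`. A last element before `l` contradicts
    -- the choice of `p'`, one equal to `l` contradicts the choice of `p`, and one after `l` makes a
    -- crossing.
    rcases lt_trichotomy (blockMax π p') l with h4 | h4 | h4
    · exact hq3 _ (by omega) h4 (((ih p' _ (by omega) h4).1 h3.symm).symm.trans hq2)
    · rw [h4] at h3
      exact hp3 p' (by omega) hq1 h3.symm
    · have := isNonCrossing_iff.1 hπ p p' l _ (by omega) hq1 h4 hp2 h3.symm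
      exact hp3 p' (by omega) hq1 (this.symm.trans hp2)
  have pred : ∀ (π : Part k) (l : Fin k), blockMin π l ≠ l → ∃ p, p < l ∧ π.part p = π.part l ∧
      ∀ q, p < q → q < l → π.part q ≠ π.part l := by
    intro π l hl
    have hne : ((π.part l).filter (· < l)).Nonempty :=
      ⟨blockMin π l, Finset.mem_filter.2 ⟨blockMin_mem π l, lt_of_le_of_ne (blockMin_le rfl) hl⟩⟩
    obtain ⟨h1, h2⟩ := Finset.mem_filter.1 (Finset.max'_mem _ hne)
    refine ⟨_, h2, (mem_part_iff π).1 h1, fun q h3 h4 h5 => ?_⟩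
    exact absurd (Finset.le_max' _ q (Finset.mem_filter.2 ⟨(mem_part_iff π).2 h5, h4⟩))
      (not_le.2 h3)
  intro m
  induction m with
  | zero => intro i j _ h; omega
  | succ m ih =>
    intro i j hij hj
    by_cases hjm : (j : ℕ) < m
    · exact ih i j hij hjm
    have ih' : ∀ i' j' : Fin k, i' < j' → j' < j →
      (π.part i' = π.part j' ↔ π'.part i' = π'.part j') := fun i' j' h1 h2 =>
        ih i' j' h1 (by omega)
    by_cases hm : blockMin π j = j
    · refine ⟨fun h1 => ?_, fun h1 => ?_⟩
      · have : blockMin π j ≤ i := blockMin_le h1.symm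
        omega
      · have : blockMin π' j ≤ i := blockMin_le h1.symm
        have := (hmin j).1 hm
        omega
    · obtain ⟨p, hp1, hp2, hp3⟩ := pred π j hm
      obtain ⟨p', hq1, hq2, hq3⟩ := pred π' j (fun h => hm ((hmin j).2 h))
      have hpp : p = p' := le_antisymm
        (key π' π hπ' hπ (fun i => (hmax i).symm) j p' p (fun i j h1 h2 => (ih' i j h1 h2).symm)
          hq1 hq2 hq3 hp1 hp2 hp3)
        (key π π' hπ hπ' hmax j p p' ih' hp1 hp2 hp3 hq1 hq2 hq3)
      subst hpp
      rw [← hp2, ← hq2]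
      rcases lt_trichotomy i p with h1 | h1 | h1
      · exact ih' i p h1 hp1
      · rw [h1]; simp
      · rw [hp2, hq2]
        exact iff_of_false (hp3 i h1 hij) (hq3 i h1 hij)

theorem part_ext {π π' : Part k} (h : ∀ i j, π.part i = π.part j ↔ π'.part i = π'.part j) :
    π = π' := by
  have hp : ∀ i, π.part i = π'.part i := fun i => by
    ext j
    rw [mem_part_iff, mem_part_iff, h]
  ext B
  constructor <;> intro hB
  · obtain ⟨i, hi⟩ := π.nonempty_of_mem_parts hB
    rw [← π.part_eq_of_mem hB hi, hp]
    exact part_mem_parts π' i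
  · obtain ⟨i, hi⟩ := π'.nonempty_of_mem_parts hB
    rw [← π'.part_eq_of_mem hB hi, ← hp]
    exact part_mem_parts π i

/-- A non-crossing partition is determined by the first and the last elements of its blocks. -/
theorem kind_injOn : Set.InjOn (kind (k := k)) {π | IsNonCrossing π} := by
  intro π hπ π' hπ' h
  refine part_ext fun i j => ?_
  rcases lt_trichotomy i j with h1 | h1 | h1
  · exact ⟨part_eq_of_kind_eq hπ hπ' h k i j h1 j.2,
      part_eq_of_kind_eq hπ' hπ h.symm k i j h1 j.2⟩
  · rw [h1]; simp
  · rw [eq_comm, eq_comm (a := π'.part i)]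
    exact ⟨part_eq_of_kind_eq hπ hπ' h k j i h1 i.2,
      part_eq_of_kind_eq hπ' hπ h.symm k j i h1 i.2⟩

/-- Each element carries one of four marks, and the marks determine the partition. -/
theorem card_nonCrossingPart_le (k : ℕ) : (nonCrossingPart k).card ≤ 4 ^ k := by
  have h := Finset.card_le_card_of_injOn (s := nonCrossingPart k) (t := Finset.univ) kind
    (fun _ _ => Finset.mem_coe.2 (Finset.mem_univ _)) (kind_injOn.mono fun π h => by
      simpa [nonCrossingPart] using h)
  simpa using h

/-- The stack after `m` letters of the word of `π` with the labels `v`. -/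
def stackAt (π : Part k) (v : Fin k → V) (m : ℕ) : List (V × ℕ) :=
  (openList π m).map fun i => (v i, countUpTo π i m)

/-- The condition on the labels at the letter `m`. -/
def LabelOK (G : Digraph V) (π : Part k) (v : Fin k → V) (m : Fin k) : Prop :=
  if blockMin π m = m then ∀ a ∈ (coverList π m).head?, G.Adj (v a) (v m)
  else v (blockMin π m) = v m

theorem map_coverList (v : Fin k → V) (m : Fin k) :
    (coverList π m).map (fun i => (v i, countUpTo π i (m + 1))) =
      (coverList π m).map (fun i => (v i, countUpTo π i m)) := by
  refine List.map_congr_left fun i hi => ?_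
  rw [coverList, Finset.mem_sort] at hi
  rw [countUpTo_succ_of_ne (part_ne_of_mem_coverAt hi)]

/-- Whether the letter pushes or only counts, the block of `m` ends up on top of its covering
blocks, with its counter updated past `m`. -/
theorem enter_stackAt (hπ : IsNonCrossing π) (v : Fin k → V) (m : Fin k) :
    enter (kind π m).1 (v m) (stackAt π v m) =
      (v (blockMin π m), countUpTo π (blockMin π m) (m + 1)) ::
        (coverList π m).map (fun i => (v i, countUpTo π i (m + 1))) := by
  rw [map_coverList, stackAt, openList_eq hπ]
  by_cases h : blockMin π m = m
  · simp only [kind, h, decide_true, if_true, enter, countUpTo_self_succ]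
  · simp only [kind, h, decide_false, if_false, enter, List.map_cons, countUpTo_succ h]

theorem stackAt_succ (hπ : IsNonCrossing π) (v : Fin k → V) (m : Fin k) :
    stackAt π v (m + 1) = stackStep (v m, kind π m) (stackAt π v m) := by
  rw [stackStep, enter_stackAt hπ, stackAt, openList_succ hπ]
  by_cases h : blockMax π m = m
  · simp only [kind, h, decide_true, if_true, leave, List.tail_cons]
  · simp only [kind, h, decide_false, if_false, leave, List.map_cons]

theorem enterOK_stackAt (G : Digraph V) (hπ : IsNonCrossing π) (v : Fin k → V) (m : Fin k) :
    EnterOK G (kind π m).1 (v m) (stackAt π v m) ↔ LabelOK G π v m := by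
  rw [stackAt, openList_eq hπ, LabelOK]
  by_cases h : blockMin π m = m
  · simp [kind, h, EnterOK]
  · simp [kind, h, EnterOK]

open scoped Classical in
-- The stacks of the word are the explicit lists `stackAt`. The weight therefore factors into label
-- conditions and one cumulant per block, paid at its maximum.
theorem runWeight_kind (G : Digraph V) (c : ℕ → R) (hπ : IsNonCrossing π) (v : Fin k → V) :
    runWeight G c k (fun i => (v i, kind π i)) [] =
      if ∀ m, LabelOK G π v m then ∏ B ∈ π.parts, c B.card else 0 := by
  have h0 : stackAt π v 0 = [] := by simp [stackAt, openList_zero]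
  have hk : stackAt π v k = [] := by simp [stackAt, openList_last]
  rw [← h0, runWeight_eq_prod G c k _ (stackAt π v) (stackAt_succ hπ v) hk]
  have h1 : ∀ m : Fin k, stepWeight G c (v m, kind π m) (stackAt π v m) =
      if LabelOK G π v m then (if blockMax π m = m then c (π.part m).card else 1) else 0 := by
    intro m
    rw [stepWeight]
    refine if_congr (enterOK_stackAt G hπ v m) ?_ rfl
    rw [enter_stackAt hπ]
    by_cases h : blockMax π m = m
    · simp only [kind, h, decide_true, leaveWeight, if_true, countUpTo_blockMax h]
    · simp only [kind, h, decide_false, leaveWeight, if_false]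
  simp only [h1]
  split_ifs with h
  · simp only [h, if_true]
    exact prod_blockMax c
  · push Not at h
    obtain ⟨m, hm⟩ := h
    exact Finset.prod_eq_zero (Finset.mem_univ m) (if_neg hm)

open scoped Classical in
-- Each word splits into its labels and its marks. Marks that come from no non-crossing partition
-- contribute 0, and the others are indexed injectively by `kind`.
theorem runSum_eq_sum_labels [Fintype V] (G : Digraph V) (c : ℕ → R) (k : ℕ) :
    runSum G c k [] = ∑ π ∈ nonCrossingPart k,
      (Nat.card {v : Fin k → V // ∀ m, LabelOK G π v m} : R) * ∏ B ∈ π.parts, c B.card := by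
  rw [runSum_eq_sum_runWeight]
  have e : ∑ x : Fin k → V × Bool × Bool, runWeight G c k x [] =
      ∑ w : Fin k → Bool × Bool, ∑ v : Fin k → V, runWeight G c k (fun i => (v i, w i)) [] := by
    rw [← (Equiv.arrowProdEquivProdArrow (Fin k) (fun _ => V)
      (fun _ => Bool × Bool)).symm.sum_comp, Fintype.sum_prod_type_right]
    rfl
  rw [e, ← Finset.sum_subset (Finset.subset_univ ((nonCrossingPart k).image kind)),
    Finset.sum_image (kind_injOn.mono fun π h => by simpa [nonCrossingPart] using h)]
  · refine Finset.sum_congr rfl fun π hπ => ?_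
    have hπ' : IsNonCrossing π := by simpa [nonCrossingPart] using hπ
    simp only [runWeight_kind G c hπ']
    rw [← Finset.sum_filter, Finset.sum_const, nsmul_eq_mul, Nat.card_eq_fintype_card,
      Fintype.card_subtype]
  · intro w _ hw
    refine Finset.sum_eq_zero fun v _ => ?_
    by_contra h
    obtain ⟨π, hπ, h1⟩ := exists_part_of_runWeight_ne_zero G c k _ h
    refine hw (Finset.mem_image.2 ⟨π, by simpa [nonCrossingPart] using hπ, funext fun i => ?_⟩)
    have h2 := h1 i
    simp only at h2
    simp [kind, h2]

end Labels

/-! ### The nesting forest -/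

section Nesting

variable {V : Type*} {k : ℕ} {π : Part k}

theorem mem_coverAt_blockMin {a b : Fin k} :
    a ∈ coverAt π (blockMin π b) ↔
      blockMin π a = a ∧ a < blockMin π b ∧ blockMin π b ≤ blockMax π a := by
  simp [coverAt, blockMin_blockMin]

/-- For non-crossing partitions nesting can be tested on the first element of the inner block: if
that element lies between two elements of the outer block, the whole inner block lies in the same
gap. -/
theorem nested_part_iff (hπ : IsNonCrossing π) (i j : Fin k) :
    Nested (π.part i) (π.part j) ↔ blockMin π i ∈ coverAt π (blockMin π j) := by
  rw [mem_coverAt_blockMin, blockMin_blockMin, blockMax_congr (part_blockMin π i)]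
  have hmem := fun a b => mem_part_iff π (i := a) (j := b)
  rw [isNonCrossing_iff] at hπ
  constructor
  · rintro ⟨x, hx, y, hy, -, h1, -⟩
    have h2 := Finset.mem_Ioo.1 (h1 (blockMin_mem π j))
    rw [hmem] at hx hy
    have h3 : blockMin π i ≤ x := blockMin_le hx.symm
    have h4 : y ≤ blockMax π i := le_blockMax hy.symm
    exact ⟨rfl, by omega, by omega⟩
  · rintro ⟨-, h1, h2⟩
    have hij : π.part i ≠ π.part j := fun h => by
      rw [blockMin_congr h] at h1
      exact lt_irrefl _ h1
    have h2' : blockMin π j ≠ blockMax π i := fun h => hij (by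
      rw [← part_blockMax π i, ← h, part_blockMin])
    -- The gap is bounded by the last element of the outer block before `blockMin π j` and the first
    -- one after it.
    have hne1 : ((π.part i).filter (· < blockMin π j)).Nonempty :=
      ⟨blockMin π i, Finset.mem_filter.2 ⟨blockMin_mem π i, h1⟩⟩
    have hne2 : ((π.part i).filter (blockMin π j < ·)).Nonempty :=
      ⟨blockMax π i, Finset.mem_filter.2 ⟨blockMax_mem π i, by omega⟩⟩
    have m1 := Finset.mem_filter.1 (Finset.max'_mem _ hne1)
    have m2 := Finset.mem_filter.1 (Finset.min'_mem _ hne2)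
    have u1 : ∀ q ∈ π.part i, q < blockMin π j → q ≤ Finset.max' _ hne1 := fun q hq1 hq2 =>
      Finset.le_max' _ q (Finset.mem_filter.2 ⟨hq1, hq2⟩)
    have u2 : ∀ q ∈ π.part i, blockMin π j < q → Finset.min' _ hne2 ≤ q := fun q hq1 hq2 =>
      Finset.min'_le _ q (Finset.mem_filter.2 ⟨hq1, hq2⟩)
    set x := Finset.max' _ hne1
    set y := Finset.min' _ hne2
    refine ⟨x, m1.1, y, m2.1, by omega, fun l hl => ?_, ?_⟩
    · have hl' := (hmem _ _).1 hl
      have h3 : blockMin π j ≤ l := blockMin_le hl'.symm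
      refine Finset.mem_Ioo.2 ⟨by omega, ?_⟩
      by_contra h4
      have h5 : l ≠ y := by
        rintro rfl
        exact hij (((hmem _ _).1 m2.1).symm.trans hl')
      have := hπ x (blockMin π j) y l m1.2 m2.2 (by omega)
        (((hmem _ _).1 m1.1).trans ((hmem _ _).1 m2.1).symm) ((part_blockMin π j).trans hl'.symm)
      exact hij (((hmem _ _).1 m1.1).symm.trans (this.trans (part_blockMin π j)))
    · rw [Finset.disjoint_left]
      intro l hl1 hl2
      rw [Finset.mem_Ioo] at hl1
      rcases lt_trichotomy l (blockMin π j) with h | h | h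
      · have := u1 l hl2 h
        omega
      · rw [h, hmem, part_blockMin] at hl2
        exact hij hl2.symm
      · have := u2 l hl2 h
        omega

theorem mem_head?_iff_of_sortedGT {α : Type*} [LinearOrder α] {l : List α} (h : l.SortedGT) (a : α) :
    a ∈ l.head? ↔ a ∈ l ∧ ∀ b ∈ l, b ≤ a := by
  cases l with
  | nil => simp
  | cons x l =>
    have h1 := List.pairwise_cons.1 h.pairwise
    simp only [List.head?_cons, Option.mem_some, List.mem_cons, forall_eq_or_imp]
    constructor
    · rintro rfl
      exact ⟨Or.inl rfl, le_rfl, fun b hb => (h1.1 b hb).le⟩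
    · rintro ⟨rfl | h2, h3, -⟩
      · rfl
      · exact absurd (h1.1 a h2) (not_lt.2 h3)

/-- Among the blocks covering a given one, the immediate predecessor for nesting is the one that
starts last, which is the head of the decreasing list. -/
theorem nestingForest_adj_iff (hπ : IsNonCrossing π) (i j : Fin k) :
    (nestingForest π).Adj ⟨π.part i, part_mem_parts π i⟩ ⟨π.part j, part_mem_parts π j⟩ ↔
      blockMin π i ∈ (coverList π (blockMin π j)).head? := by
  rw [coverList, mem_head?_iff_of_sortedGT (Finset.sortedGT_sort _), Finset.mem_sort]
  simp only [nestingForest, nested_part_iff hπ, Finset.mem_sort]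
  refine and_congr_right fun h1 => ?_
  rw [not_exists]
  rw [mem_coverAt_blockMin] at h1
  constructor
  · intro h c hc
    by_contra hlt
    rw [mem_coverAt_blockMin] at hc
    refine h ⟨π.part c, part_mem_parts π c⟩ ⟨?_, ?_⟩
    · rw [nested_part_iff hπ, mem_coverAt_blockMin, hc.1]
      exact ⟨h1.1, by omega, by omega⟩
    · rw [nested_part_iff hπ, mem_coverAt_blockMin, hc.1]
      exact hc
  · rintro h ⟨C, hC⟩ ⟨h2, h3⟩
    obtain ⟨c, hc⟩ := π.nonempty_of_mem_parts hC
    obtain rfl := π.part_eq_of_mem hC hc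
    rw [nested_part_iff hπ] at h2 h3
    have h4 := h _ h3
    rw [mem_coverAt_blockMin] at h2
    omega

theorem exists_eq_part (B : π.parts) : ∃ i, B = ⟨π.part i, part_mem_parts π i⟩ ∧ blockMin π i = i := by
  obtain ⟨i, hi⟩ := π.nonempty_of_mem_parts B.2
  refine ⟨blockMin π i, Subtype.ext ?_, blockMin_blockMin i⟩
  simp only [part_blockMin, π.part_eq_of_mem B.2 hi]

theorem nestingForest_parent_unique (hπ : IsNonCrossing π) (A A' B : π.parts)
    (h : (nestingForest π).Adj A B) (h' : (nestingForest π).Adj A' B) : A = A' := by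
  obtain ⟨i, rfl, hi⟩ := exists_eq_part A
  obtain ⟨i', rfl, hi'⟩ := exists_eq_part A'
  obtain ⟨j, rfl, hj⟩ := exists_eq_part B
  rw [nestingForest_adj_iff hπ] at h h'
  have := Option.mem_unique h h'
  rw [hi, hi'] at this
  rw [this]

/-- The position of the first element of a block. -/
def blockRank (B : π.parts) : ℕ := B.1.min' (π.nonempty_of_mem_parts B.2)

theorem blockRank_lt (hπ : IsNonCrossing π) (A B : π.parts) (h : (nestingForest π).Adj A B) :
    blockRank A < blockRank B := by
  obtain ⟨i, rfl, -⟩ := exists_eq_part A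
  obtain ⟨j, rfl, -⟩ := exists_eq_part B
  have h1 := (nested_part_iff hπ i j).1 h.1
  exact (mem_coverAt_blockMin.1 h1).2.1

theorem LabelOK.apply_blockMin {G : Digraph V} {v : Fin k → V} (h : ∀ m, LabelOK G π v m)
    (m : Fin k) : v (blockMin π m) = v m := by
  have h1 := h m
  rw [LabelOK] at h1
  split_ifs at h1 with h2
  · rw [h2]
  · exact h1

/-- Admissible labels of the elements are homomorphisms from the nesting forest. -/
def labelEquiv (G : Digraph V) (hπ : IsNonCrossing π) :
    {v : Fin k → V // ∀ m, LabelOK G π v m} ≃ DigraphHom (nestingForest π) G where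
  toFun v :=
    { toFun := fun B => v.1 (B.1.min' (π.nonempty_of_mem_parts B.2))
      map_rel' := by
        intro A B h
        obtain ⟨i, rfl, -⟩ := exists_eq_part A
        obtain ⟨j, rfl, hj⟩ := exists_eq_part B
        rw [nestingForest_adj_iff hπ] at h
        have h1 := v.2 (blockMin π j)
        rw [LabelOK, if_pos (blockMin_blockMin j)] at h1
        exact h1 _ h }
  invFun φ := ⟨fun i => φ ⟨π.part i, part_mem_parts π i⟩, fun m => by
    rw [LabelOK]
    split_ifs with h
    · intro a ha
      apply φ.map_rel
      rw [nestingForest_adj_iff hπ, h]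
      have : a ∈ coverAt π m := (Finset.mem_sort _).1 (List.mem_of_mem_head? ha)
      rwa [(Finset.mem_filter.1 this).2.1]
    · simp only [part_blockMin]⟩
  left_inv v := by
    ext i
    exact LabelOK.apply_blockMin v.2 i
  right_inv φ := by
    ext B
    obtain ⟨i, rfl, -⟩ := exists_eq_part B
    change φ ⟨π.part (blockMin π i), _⟩ = _
    simp only [part_blockMin]

theorem runSum_eq_sum_hom {R : Type*} [CommRing R] [Fintype V] (G : Digraph V) (c : ℕ → R) (k : ℕ) :
    runSum G c k [] = ∑ π ∈ nonCrossingPart k,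
      (Nat.card (DigraphHom (nestingForest π) G) : R) * ∏ B ∈ π.parts, c B.card := by
  classical
  rw [runSum_eq_sum_labels]
  refine Finset.sum_congr rfl fun π hπ => ?_
  rw [Nat.card_congr (labelEquiv G (by simpa [nonCrossingPart] using hπ))]

/-- A missing element inside the convex hull of a block lies in a block nested in it, and then the
innermost covering block supplies an edge. -/
theorem isInterval_iff_no_edge : IsInterval π ↔
    IsNonCrossing π ∧ ∀ A B, ¬ (nestingForest π).Adj A B := by
  constructor
  · intro h
    have hI : ∀ i j l : Fin k, π.part i = π.part l → i ≤ j → j ≤ l → π.part j = π.part i := by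
      intro i j l h1 h2 h3
      obtain ⟨x, y, hxy⟩ := h _ (part_mem_parts π i)
      have e1 := mem_part_refl π i
      have e2 : l ∈ π.part i := (mem_part_iff π).2 h1.symm
      rw [hxy, Finset.mem_Icc] at e1 e2
      rw [← mem_part_iff, hxy, Finset.mem_Icc]
      exact ⟨by omega, by omega⟩
    have hπ : IsNonCrossing π := isNonCrossing_iff.2 fun i i' j j' h1 h2 h3 h4 h5 =>
      (hI i i' j h4 h1.le h2.le).symm
    refine ⟨hπ, fun A B h => ?_⟩
    obtain ⟨i, rfl, hi⟩ := exists_eq_part A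
    obtain ⟨j, rfl, hj⟩ := exists_eq_part B
    have h1 := (nested_part_iff hπ i j).1 h.1
    rw [mem_coverAt_blockMin, blockMax_congr (part_blockMin π i), hi, hj] at h1
    have h2 := hI i j _ (part_blockMax π i).symm h1.2.1.le h1.2.2
    have h3 := blockMin_congr h2
    omega
  · rintro ⟨hπ, h⟩ B hB
    obtain ⟨i, hi, -⟩ := exists_eq_part ⟨B, hB⟩
    obtain rfl : B = π.part i := congrArg Subtype.val hi
    refine ⟨blockMin π i, blockMax π i, ?_⟩
    ext l
    rw [Finset.mem_Icc]
    refine ⟨fun hl => ?_, fun hl => ?_⟩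
    · have := ((mem_part_iff π).1 hl).symm
      exact ⟨blockMin_le this, le_blockMax this⟩
    · by_contra hli
      have hne : π.part i ≠ π.part l := fun e => hli ((mem_part_iff π).2 e.symm)
      have hl1 : blockMin π i ≠ l := fun e => hne (by rw [← e, part_blockMin])
      have hl2 : blockMax π i ≠ l := fun e => hne (by rw [← e, part_blockMax])
      have h1 : blockMin π i ≠ blockMin π l := fun e => hne (part_eq_iff_blockMin.2 e)
      have h2 : blockMin π l ≤ l := blockMin_le rfl
      have h3 : blockMin π i ∈ coverAt π (blockMin π l) := by
        rw [mem_coverAt_blockMin, blockMin_blockMin, blockMax_congr (part_blockMin π i)]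
        refine ⟨rfl, ?_, by omega⟩
        by_contra h4
        have := isNonCrossing_iff.1 hπ (blockMin π l) (blockMin π i) l (blockMax π i) (by omega)
          (by omega) (by omega) (part_blockMin π l) ((part_blockMin π i).trans (part_blockMax π i).symm)
        rw [part_blockMin, part_blockMin] at this
        exact hne this.symm
      have h4 : coverList π (blockMin π l) ≠ [] := fun e => by
        have := (Finset.mem_sort (· ≥ ·)).2 h3
        rw [← coverList, e] at this
        simp at this
      obtain ⟨a, s, hs⟩ := List.exists_cons_of_ne_nil h4
      have ha : a ∈ coverAt π (blockMin π l) := (Finset.mem_sort (· ≥ ·)).1 (by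
        rw [← coverList, hs]; simp)
      refine h ⟨π.part a, part_mem_parts π a⟩ ⟨π.part l, part_mem_parts π l⟩ ?_
      rw [nestingForest_adj_iff hπ, hs, (mem_coverAt_blockMin.1 ha).1]
      simp

end Nesting

/-! ### Forests -/

section Forest

variable {W : Type*} {T : Digraph W}

theorem isDirectedPath_iff {u w : W} {l : List W} : IsDirectedPath T u w l ↔
    (u = w ∧ l = [w]) ∨ ∃ x l', l = l' ++ [w] ∧ IsDirectedPath T u x l' ∧ T.Adj x w := by
  rcases List.eq_nil_or_concat' l with rfl | ⟨l', a, rfl⟩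
  · simp [IsDirectedPath]
  · rcases List.eq_nil_or_concat' l' with rfl | ⟨l'', b, rfl⟩
    · simp only [IsDirectedPath, List.nil_append, List.isChain_singleton, List.head?_cons,
        List.getLast?_singleton, Option.some.injEq, true_and]
      constructor
      · rintro ⟨rfl, rfl⟩
        exact Or.inl ⟨rfl, rfl⟩
      · rintro (⟨rfl, h⟩ | ⟨x, l', h, h1, -⟩)
        · simpa using h
        · have : l' = [] := by simpa using congrArg List.length h
          subst this
          simp at h1
    · constructor
      · rintro ⟨h1, h2, h3⟩
        obtain rfl : a = w := by simpa using h3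
        rw [List.isChain_append] at h1
        refine Or.inr ⟨b, l'' ++ [b], by simp, ⟨h1.1, ?_, by simp⟩, h1.2.2 b (by simp) a (by simp)⟩
        cases l'' <;> simpa using h2
      · rintro (⟨-, h⟩ | ⟨x, l', h, ⟨h1, h2, h3⟩, h4⟩)
        · simpa using congrArg List.length h
        · obtain ⟨rfl, h5⟩ := List.append_inj' h rfl
          obtain rfl : a = w := by simpa using h5
          refine ⟨List.isChain_append.2 ⟨h1, List.isChain_singleton _, ?_⟩, ?_, by simp⟩
          · intro y hy z hz
            rw [h3] at hy
            simp only [Option.mem_some, List.head?_cons] at hy hz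
            rw [← hy, ← hz]
            exact h4
          · cases l'' <;> simpa using h2

theorem isDirectedPath_self (u : W) : IsDirectedPath T u u [u] :=
  isDirectedPath_iff.2 (Or.inl ⟨rfl, rfl⟩)

/-- The path is reconstructed backwards from its endpoint: parents are unique, and the root has
none. -/
theorem IsDirectedPath.unique_of_root {r : W} (hr : ∀ x, ¬ T.Adj x r)
    (hpar : ∀ a b w, T.Adj a w → T.Adj b w → a = b) (l : List W) :
    ∀ (w : W) (l' : List W), IsDirectedPath T r w l → IsDirectedPath T r w l' → l = l' := by
  induction l using List.reverseRecOn with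
  | nil =>
    intro w l' h
    simp [IsDirectedPath] at h
  | append_singleton l a ih =>
    intro w l' h h'
    rcases isDirectedPath_iff.1 h with ⟨rfl, h1⟩ | ⟨x, m, h1, h2, h3⟩
    · rcases isDirectedPath_iff.1 h' with ⟨-, h1'⟩ | ⟨x', m', h1', h2', h3'⟩
      · rw [h1, h1']
      · exact absurd h3' (hr x')
    · rcases isDirectedPath_iff.1 h' with ⟨rfl, h1'⟩ | ⟨x', m', h1', h2', h3'⟩
      · exact absurd h3 (hr x)
      · obtain rfl := hpar x x' w h3 h3'
        obtain ⟨rfl, h4⟩ := List.append_inj' h1 rfl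
        rw [h1, h1', ih x m' h2 h2']

/-- A component of a well-founded digraph with unique parents is a rooted tree. -/
theorem isRootedTree_component {F : Digraph W} (hpar : ∀ a b w, F.Adj a w → F.Adj b w → a = b)
    (rank : W → ℕ) (hrank : ∀ a b, F.Adj a b → rank a < rank b)
    (c : F.toSimpleGraphInclusive.ConnectedComponent) : IsRootedTree (induced F c.supp) := by
  have hne : c.supp.Nonempty := c.nonempty_supp
  have hadj : ∀ {a b}, F.Adj a b → (a ∈ c.supp ↔ b ∈ c.supp) := by
    intro a b h
    simp only [SimpleGraph.ConnectedComponent.mem_supp_iff]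
    have h1 : F.toSimpleGraphInclusive.Adj a b :=
      ⟨fun h2 => by rw [h2] at h; exact lt_irrefl _ (hrank _ _ h), Or.inl h⟩
    rw [SimpleGraph.ConnectedComponent.connectedComponentMk_eq_of_adj h1]
  -- A vertex of least rank in the component has no parent, so it serves as the root.
  obtain ⟨r, hrc, hr⟩ : ∃ r ∈ c.supp, ∀ w ∈ c.supp, rank r ≤ rank w := by
    obtain ⟨r, h1, h2⟩ := (measure rank).wf.has_min c.supp hne
    exact ⟨r, h1, fun w hw => not_lt.1 (h2 w hw)⟩
  have hroot : ∀ x, ¬ F.Adj x r := fun x h =>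
    absurd (hrank _ _ h) (not_lt.2 (hr x ((hadj h).2 hrc)))
  have hreach : ∀ w, F.toSimpleGraphInclusive.Reachable r w →
      ∃ h : w ∈ c.supp, ∃ l, IsDirectedPath (induced F c.supp) ⟨r, hrc⟩ ⟨w, h⟩ l := by
    intro w h
    rw [SimpleGraph.reachable_iff_reflTransGen] at h
    induction h with
    | refl => exact ⟨hrc, _, isDirectedPath_self _⟩
    | tail _ h2 ih =>
      obtain ⟨h3, l, hl⟩ := ih
      rcases h2 with ⟨-, h4 | h4⟩
      · exact ⟨(hadj h4).1 h3, _, isDirectedPath_iff.2 (Or.inr ⟨_, l, rfl, hl, h4⟩)⟩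
      -- A step against an edge leads to the parent. By uniqueness this is the vertex before last on
      -- the directed path already found, so truncating that path suffices.
      · refine ⟨(hadj h4).2 h3, ?_⟩
        rcases isDirectedPath_iff.1 hl with ⟨h5, -⟩ | ⟨x, l', -, h6, h7⟩
        · obtain rfl := congrArg Subtype.val h5
          exact absurd h4 (hroot _)
        · obtain rfl := hpar _ _ _ h7 h4
          exact ⟨l', h6⟩
  refine ⟨⟨r, hrc⟩, fun w => ?_⟩
  obtain ⟨_, l, hl⟩ := hreach w.1 (by
    rw [← SimpleGraph.ConnectedComponent.eq]
    exact hrc.trans w.2.symm)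
  refine ⟨l, hl, fun l' hl' => IsDirectedPath.unique_of_root (fun x hx => hroot x.1 hx)
    (fun a b w h h' => Subtype.ext (hpar _ _ _ h h')) l' w l hl' hl⟩

/-- A homomorphism is a family of homomorphisms from the components. -/
def homEquivPi {V : Type*} (F : Digraph W) (G : Digraph V)
    (hirr : ∀ a, ¬ F.Adj a a) :
    DigraphHom F G ≃ ((c : F.toSimpleGraphInclusive.ConnectedComponent) →
      DigraphHom (induced F c.supp) G) where
  toFun φ c := ⟨fun a => φ a.1, fun h => φ.map_rel h⟩
  invFun ψ := ⟨fun a => ψ (F.toSimpleGraphInclusive.connectedComponentMk a) ⟨a, rfl⟩, by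
    intro a b h
    have h1 : F.toSimpleGraphInclusive.Adj a b :=
      ⟨fun h2 => by rw [h2] at h; exact hirr _ h, Or.inl h⟩
    have h2 := SimpleGraph.ConnectedComponent.connectedComponentMk_eq_of_adj h1
    have h3 : ∀ (c : F.toSimpleGraphInclusive.ConnectedComponent) (ha : a ∈ c.supp),
        ψ (F.toSimpleGraphInclusive.connectedComponentMk a) ⟨a, rfl⟩ = ψ c ⟨a, ha⟩ := by
      rintro c rfl
      rfl
    rw [h3 _ h2]
    exact (ψ _).map_rel h⟩
  left_inv φ := rfl
  right_inv ψ := by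
    ext c ⟨a, ha⟩
    obtain rfl := ha
    rfl

/-- Homomorphisms from a forest are independent choices on its components, and vertex counts add up.
The density is thus a finite product of tree densities, to each of which `hβ` applies. -/
theorem tendsto_forestCoeff {V : ℕ → Type*} [∀ n, Fintype (V n)]
    (G : ∀ n, Digraph (V n)) (β : (W : Type) → Digraph W → ℝ)
    (hβ : ∀ (W : Type) [Fintype W] (T : Digraph W), IsRootedTree T →
      Tendsto (fun n => (Nat.card (DigraphHom T (G n)) : ℝ) /
        (Fintype.card (V n) : ℝ) ^ Fintype.card W) atTop (𝓝 (β W T)))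
    {W : Type} [Fintype W] (F : Digraph W) (hpar : ∀ a b w, F.Adj a w → F.Adj b w → a = b)
    (rank : W → ℕ) (hrank : ∀ a b, F.Adj a b → rank a < rank b) :
    Tendsto (fun n => (Nat.card (DigraphHom F (G n)) : ℝ) /
        (Fintype.card (V n) : ℝ) ^ Fintype.card W) atTop (𝓝 (forestCoeff β F)) := by
  classical
  have hirr : ∀ a, ¬ F.Adj a a := fun a h => lt_irrefl _ (hrank a a h)
  have hcard : Fintype.card W =
      ∑ c : F.toSimpleGraphInclusive.ConnectedComponent, Fintype.card c.supp := by
    rw [← Fintype.card_sigma]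
    exact Fintype.card_congr
      (Equiv.sigmaFiberEquiv F.toSimpleGraphInclusive.connectedComponentMk).symm
  have h : ∀ n, (Nat.card (DigraphHom F (G n)) : ℝ) / (Fintype.card (V n) : ℝ) ^ Fintype.card W =
      ∏ c : F.toSimpleGraphInclusive.ConnectedComponent,
        (Nat.card (DigraphHom (induced F c.supp) (G n)) : ℝ) /
          (Fintype.card (V n) : ℝ) ^ Fintype.card c.supp := by
    intro n
    rw [Nat.card_congr (homEquivPi F (G n) hirr), Nat.card_pi, hcard, Finset.prod_div_distrib,
      Finset.prod_pow_eq_pow_sum, Nat.cast_prod]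
  simp only [h]
  rw [forestCoeff, finprod_eq_prod_of_fintype]
  exact tendsto_finsetProd _ fun c _ => hβ c.supp _ (isRootedTree_component hpar rank hrank c)

theorem natCard_digraphHom_le {V : Type*} [Fintype W] [Fintype V] (F : Digraph W) (G : Digraph V) :
    Nat.card (DigraphHom F G) ≤ Fintype.card V ^ Fintype.card W := by
  classical
  rw [← Fintype.card_fun, ← Nat.card_eq_fintype_card]
  exact Nat.card_le_card_of_injective (fun φ : DigraphHom F G => (φ : W → V))
    DFunLike.coe_injective

end Forest

/-! ### The action of `ι_v(a)` on elementary tensors -/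

section Action

universe u

variable {V : Type u} (G : Digraph V) (H : V → PointedHilbert)

theorem extMap_tmul (v : V) (s : ExtPath G v) (b : (H v).carrier) (y : Word H s.1) :
    extMap G H v s (b ⊗ₜ y) = ⟪(H v).vec, b⟫_ℂ • summand G H s.1 s.2.tail y +
      summand G H (v :: s.1) s.2 ((H v).perp.orthogonalProjectionOnto b ⊗ₜ[ℂ] y) := by
  have h1 : vacPart (H v) (Word H s.1) (b ⊗ₜ y) = ⟪(H v).vec, b⟫_ℂ • y := rfl
  rw [extMap, add_apply, ContinuousLinearMap.comp_apply, ContinuousLinearMap.comp_apply, h1,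
    map_smul]
  rfl

theorem PointedHilbert.inner_vec_vec (K : PointedHilbert) : ⟪K.vec, K.vec⟫_ℂ = 1 := by
  rw [inner_self_eq_norm_sq_to_K, K.norm_vec]
  simp

theorem PointedHilbert.inner_vec_perp (K : PointedHilbert) (b : K.perp) :
    ⟪K.vec, (b : K.carrier)⟫_ℂ = 0 :=
  Submodule.mem_orthogonal_singleton_iff_inner_right.1 b.2

theorem PointedHilbert.proj_vec (K : PointedHilbert) :
    K.perp.orthogonalProjectionOnto K.vec = 0 := by
  rw [Submodule.orthogonalProjectionOnto_eq_zero_iff, Submodule.orthogonal_orthogonal]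
  exact Submodule.mem_span_singleton_self _

theorem extMap_vec_tmul (v : V) (s : ExtPath G v) (y : Word H s.1) :
    extMap G H v s ((H v).vec ⊗ₜ y) = summand G H s.1 s.2.tail y := by
  rw [extMap_tmul, PointedHilbert.inner_vec_vec, PointedHilbert.proj_vec, TensorProduct.zero_tmul,
    one_smul]
  exact (add_eq_left.2 (map_zero _))

theorem extMap_perp_tmul (v : V) (s : ExtPath G v) (b : (H v).perp) (y : Word H s.1) :
    extMap G H v s ((b : (H v).carrier) ⊗ₜ y) = summand G H (v :: s.1) s.2 (b ⊗ₜ[ℂ] y) := by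
  rw [extMap_tmul, PointedHilbert.inner_vec_perp, zero_smul, zero_add,
    Submodule.orthogonalProjectionOnto_mem_subspace_eq_self]

variable [Std.Irrefl G.Adj]

open scoped Classical in
theorem incl_single (v : V) (s : ExtPath G v) (x : (H v).carrier ⊗[ℂ] Word H s.1) :
    incl G H v ((lp.single 2 s x : PreExt G H v) : UniformSpace.Completion (PreExt G H v)) =
      extMap G H v s x := by
  rw [incl, ContinuousLinearMap.fromCompletion_apply_coe]
  exact (orthogonal_extIso G H v).linearIsometry_apply_single x

theorem inner_incl (v : V) (x y : UniformSpace.Completion (PreExt G H v)) :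
    ⟪incl G H v x, incl G H v y⟫_ℂ = ⟪x, y⟫_ℂ := by
  induction x, y using UniformSpace.Completion.induction_on₂ with
  | hp => exact isClosed_eq (by fun_prop) (by fun_prop)
  | ih x y =>
    rw [incl, ContinuousLinearMap.fromCompletion_apply_coe,
      ContinuousLinearMap.fromCompletion_apply_coe, UniformSpace.Completion.inner_coe]
    exact (orthogonal_extIso G H v).linearIsometry.inner_map_map x y

theorem adjoint_incl_incl (v : V) (x : UniformSpace.Completion (PreExt G H v)) :
    ContinuousLinearMap.adjoint (incl G H v) (incl G H v x) = x := by
  refine ext_inner_right ℂ fun y => ?_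
  rw [ContinuousLinearMap.adjoint_inner_left, inner_incl]

theorem iota_extMap (v : V) (a : (H v).carrier →L[ℂ] (H v).carrier) (s : ExtPath G v)
    (x : (H v).carrier ⊗[ℂ] Word H s.1) :
    iota G H v a (extMap G H v s x) = extMap G H v s (a.rTensor (Word H s.1) x) := by
  classical
  rw [← incl_single, ← incl_single, iota, ContinuousLinearMap.comp_apply,
    ContinuousLinearMap.comp_apply, adjoint_incl_incl, ampl,
    ContinuousLinearMap.completion_apply_coe]
  congr 2
  ext t
  change a.rTensor (Word H t.1) ((lp.single 2 s x : PreExt G H v) t) = _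
  by_cases h : t = s
  · subst h
    rw [lp.single_apply_self, lp.single_apply_self]
  · rw [lp.single_apply_ne _ _ _ h, lp.single_apply_ne _ _ _ h, map_zero]

/-- The images of the maps `extMap` span a dense subspace of the range of `incl`; a vector
orthogonal to them is killed by the adjoint of `incl`. -/
theorem iota_eq_zero (v : V) (a : (H v).carrier →L[ℂ] (H v).carrier) (y : FreeProd G H)
    (h : ∀ s x, ⟪y, extMap G H v s x⟫_ℂ = 0) : iota G H v a y = 0 := by
  have h1 : ContinuousLinearMap.adjoint (incl G H v) y = 0 := by
    refine ext_inner_right ℂ fun z => ?_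
    rw [ContinuousLinearMap.adjoint_inner_left, inner_zero_left]
    induction z using UniformSpace.Completion.induction_on with
    | hp => exact isClosed_eq (by fun_prop) (by fun_prop)
    | ih z =>
      rw [incl, ContinuousLinearMap.fromCompletion_apply_coe]
      have h2 := (innerSL ℂ y).hasSum ((orthogonal_extIso G H v).hasSum_linearIsometry z)
      refine h2.unique ?_
      convert! hasSum_zero with s
      exact h s (z s)
  rw [iota, ContinuousLinearMap.comp_apply, ContinuousLinearMap.comp_apply, h1, map_zero, map_zero]

theorem iota_summand_of_ext (v : V) (a : (H v).carrier →L[ℂ] (H v).carrier) (p : List V)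
    (hp : IsRevPath G (v :: p)) (y : Word H p) :
    iota G H v a (summand G H p hp.tail y) =
      ⟪(H v).vec, a (H v).vec⟫_ℂ • summand G H p hp.tail y + summand G H (v :: p) hp
        ((H v).perp.orthogonalProjectionOnto (a (H v).vec) ⊗ₜ[ℂ] y) := by
  rw [← extMap_vec_tmul G H v ⟨p, hp⟩ y, iota_extMap, ContinuousLinearMap.rTensor_tmul, extMap_tmul,
    extMap_vec_tmul]

theorem iota_summand_cons (v : V) (a : (H v).carrier →L[ℂ] (H v).carrier) (p : List V)
    (hp : IsRevPath G (v :: p)) (b : (H v).perp) (y : Word H p) :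
    iota G H v a (summand G H (v :: p) hp (b ⊗ₜ[ℂ] y)) =
      ⟪(H v).vec, a b⟫_ℂ • summand G H p hp.tail y + summand G H (v :: p) hp
        ((H v).perp.orthogonalProjectionOnto (a b) ⊗ₜ[ℂ] y) := by
  rw [← extMap_perp_tmul G H v ⟨p, hp⟩ b y, iota_extMap, ContinuousLinearMap.rTensor_tmul,
    extMap_tmul]

theorem iota_summand_eq_zero (v : V) (a : (H v).carrier →L[ℂ] (H v).carrier) (p : List V)
    (hp : IsRevPath G p) (h1 : ¬ IsRevPath G (v :: p)) (h2 : ∀ q, p ≠ v :: q) (y : Word H p) :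
    iota G H v a (summand G H p hp y) = 0 := by
  refine iota_eq_zero G H v a _ fun s x => ?_
  rw [extMap, add_apply, ContinuousLinearMap.comp_apply, ContinuousLinearMap.comp_apply,
    inner_add_right, inner_summand_ne, inner_summand_ne, add_zero]
  · exact h2 _
  · rintro rfl
    exact h1 s.2

end Action

/-! ### Moments of sums of free copies -/

section Moments

/-- The vectors `(Q a)^j ξ`, where `Q` is the projection onto `H°`. -/
def boolVec (K : PointedHilbert) (a : K.carrier →L[ℂ] K.carrier) : ℕ → K.carrier
  | 0 => K.vec
  | j + 1 => K.perp.orthogonalProjectionOnto (a (boolVec K a j))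

/-- The boolean cumulants `⟨ξ, a (Q a)^{j-1} ξ⟩` of an operator. -/
def opCumulant (K : PointedHilbert) (a : K.carrier →L[ℂ] K.carrier) (j : ℕ) : ℂ :=
  ⟪K.vec, a (boolVec K a (j - 1))⟫_ℂ

universe u

variable {V : Type u} (G : Digraph V) (K : PointedHilbert) (a : K.carrier →L[ℂ] K.carrier)

/-- The elementary tensor of a stack. -/
def wordVec : (s : List (V × ℕ)) → Word (fun _ : V => K) (s.map Prod.fst)
  | [] => (1 : ℂ)
  | (_, j) :: s => K.perp.orthogonalProjectionOnto (a (boolVec K a j)) ⊗ₜ[ℂ] wordVec s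

open scoped Classical in
/-- The vector of a stack in the free product. -/
def stackVec (s : List (V × ℕ)) : FreeProd G (fun _ : V => K) :=
  if h : IsRevPath G (s.map Prod.fst) then summand G (fun _ : V => K) _ h (wordVec K a s) else 0

theorem isRevPath_cons_iff (v : V) (s : List (V × ℕ)) (hs : IsRevPath G (s.map Prod.fst)) :
    IsRevPath G (v :: s.map Prod.fst) ↔ EnterOK G true v s := by
  unfold IsRevPath at *
  rw [List.isChain_cons, and_iff_left hs]
  cases s <;> simp [EnterOK]

theorem isRevPath_stackStep (x : V × Bool × Bool) (s : List (V × ℕ))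
    (hs : IsRevPath G (s.map Prod.fst)) (hx : EnterOK G x.2.1 x.1 s) :
    IsRevPath G ((stackStep x s).map Prod.fst) := by
  have h1 : IsRevPath G ((enter x.2.1 x.1 s).map Prod.fst) := by
    obtain ⟨v, a, b⟩ := x
    cases a
    · rcases s with _ | ⟨⟨w, j⟩, s⟩
      · exact hs
      · exact hs
    · exact (isRevPath_cons_iff G v s hs).2 hx
  rw [stackStep]
  cases x.2.2
  · exact h1
  · rw [leave, List.map_tail]
    exact List.IsChain.tail h1

theorem stackVec_nil : stackVec G K a [] = vacuum G (fun _ : V => K) :=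
  dif_pos (isRevPath_nil G)

theorem inner_vacuum_stackVec (s : List (V × ℕ)) :
    ⟪vacuum G (fun _ : V => K), stackVec G K a s⟫_ℂ = if s = [] then 1 else 0 := by
  rcases s with _ | ⟨x, s⟩
  · rw [stackVec_nil, if_pos rfl]
    refine (inner_summand_same G _ [] (isRevPath_nil G) (1 : ℂ) (1 : ℂ)).trans ?_
    change ⟪(1 : ℂ), (1 : ℂ)⟫_ℂ = 1
    simp
  · rw [if_neg (List.cons_ne_nil _ _), stackVec]
    split_ifs with h
    · exact inner_summand_ne _ _ _ _ _ _ (by simp) _ _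
    · simp

variable [Std.Irrefl G.Adj]

/-- The two values of the last mark are the two parts of a vector along ξ and its complement: the
complement keeps the entry and ξ removes it. As there are no loops, pushing a new `v` and reusing a
top entry labelled `v` exclude each other. -/
theorem iota_stackVec (v : V) (s : List (V × ℕ)) (hs : IsRevPath G (s.map Prod.fst)) :
    iota G (fun _ : V => K) v a (stackVec G K a s) = ∑ x : Bool × Bool,
      stepWeight G (opCumulant K a) (v, x) s • stackVec G K a (stackStep (v, x) s) := by
  have hsv : stackVec G K a s = summand G (fun _ : V => K) _ hs (wordVec K a s) := dif_pos hs
  rw [Fintype.sum_prod_type, Fintype.sum_bool, Fintype.sum_bool, Fintype.sum_bool]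
  simp only [stepWeight, stackStep]
  by_cases h1 : EnterOK G true v s
  · have h2 : ¬ EnterOK G false v s := by
      rintro ⟨p, hp, rfl⟩
      exact Std.Irrefl.irrefl _ (h1 p hp)
    have h3 := (isRevPath_cons_iff G v s hs).2 h1
    have h4 : stackVec G K a ((v, 0) :: s) =
        summand G (fun _ : V => K) (v :: s.map Prod.fst) h3 (wordVec K a ((v, 0) :: s)) :=
      dif_pos h3
    simp only [h1, h2, if_true, if_false, zero_smul, add_zero, enter, leave, leaveWeight,
      List.tail_cons, one_smul, h4, hsv]
    exact iota_summand_of_ext G (fun _ : V => K) v a _ h3 (wordVec K a s)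
  · by_cases h2 : EnterOK G false v s
    · obtain ⟨⟨v', j⟩, hp, rfl⟩ := h2
      rcases s with _ | ⟨q, s⟩
      · simp at hp
      · obtain rfl : q = (v', j) := by simpa using hp
        have h2 : EnterOK G false v' ((v', j) :: s) := ⟨_, hp, rfl⟩
        have h3 : stackVec G K a ((v', j + 1) :: s) =
          summand G (fun _ : V => K) (v' :: s.map Prod.fst) hs (wordVec K a ((v', j + 1) :: s)) :=
          dif_pos hs
        have h4 : stackVec G K a s =
          summand G (fun _ : V => K) (s.map Prod.fst) hs.tail (wordVec K a s) :=
          dif_pos _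
        simp only [h1, h2, if_true, if_false, zero_smul, zero_add, enter, leave, leaveWeight,
          List.tail_cons, one_smul, hsv, h3, h4]
        exact iota_summand_cons G (fun _ : V => K) v' a _ hs _ (wordVec K a s)
    · simp only [h1, h2, if_false, zero_smul, add_zero, hsv]
      refine iota_summand_eq_zero G (fun _ : V => K) v a _ hs
        (fun h => h1 ((isRevPath_cons_iff G v s hs).1 h)) (fun q hq => h2 ?_) _
      rcases s with _ | ⟨⟨w, j⟩, s⟩
      · simp at hq
      · obtain rfl : w = v := by
          have := (List.cons.inj hq).1
          exact this
        exact ⟨_, rfl, rfl⟩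

/-- Only the empty stack has a component along the vacuum, so the inner product collects exactly the
words that end there. -/
theorem inner_pow_sum_iota [Fintype V] (n : ℕ) (s : List (V × ℕ))
    (hs : IsRevPath G (s.map Prod.fst)) :
    ⟪vacuum G (fun _ : V => K), ((∑ v, iota G (fun _ : V => K) v a) ^ n) (stackVec G K a s)⟫_ℂ =
      runSum G (opCumulant K a) n s := by
  induction n generalizing s with
  | zero =>
    rw [pow_zero, one_apply_eq_self, inner_vacuum_stackVec]
    cases s <;> rfl
  | succ n ih =>
    rw [pow_succ, mul_apply_eq_comp, sum_apply, runSum,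
      Fintype.sum_prod_type, map_sum, inner_sum]
    refine Finset.sum_congr rfl fun v _ => ?_
    rw [iota_stackVec G K a v s hs, map_sum, inner_sum]
    refine Finset.sum_congr rfl fun x _ => ?_
    rw [map_smul, inner_smul_right]
    by_cases h : EnterOK G x.1 v s
    · rw [ih _ (isRevPath_stackStep G (v, x) s hs h)]
    · have : stepWeight G (opCumulant K a) (v, x) s = 0 := if_neg h
      rw [this, zero_mul, zero_mul]

theorem inner_vacuum_pow_sum_iota [Fintype V] (k : ℕ) :
    ⟪vacuum G (fun _ : V => K),
      ((∑ v, iota G (fun _ : V => K) v a) ^ k) (vacuum G (fun _ : V => K))⟫_ℂ =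
      ∑ π ∈ nonCrossingPart k, (Nat.card (DigraphHom (nestingForest π) G) : ℂ) *
        ∏ B ∈ π.parts, opCumulant K a B.card := by
  rw [← runSum_eq_sum_hom, ← inner_pow_sum_iota G K a k [] (isRevPath_nil G),
    stackVec_nil]

end Moments

/-! ### Boolean cumulants -/

section Cumulants

/-! ### Sums over interval partitions -/

section Recursion

variable {R : Type*} [CommRing R] (c : ℕ → R)

theorem runSum_bot_succ_nil (n : ℕ) : runSum (⊥ : Digraph Unit) c (n + 1) [] =
    c 1 * runSum (⊥ : Digraph Unit) c n [] + runSum (⊥ : Digraph Unit) c n [((), 0)] := by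
  rw [runSum]
  simp [Fintype.sum_prod_type, stepWeight, stackStep, EnterOK, enter, leave, leaveWeight]

theorem runSum_bot_succ_singleton (n j : ℕ) :
    runSum (⊥ : Digraph Unit) c (n + 1) [((), j)] =
      c (j + 2) * runSum (⊥ : Digraph Unit) c n [] + runSum (⊥ : Digraph Unit) c n [((), j + 1)] := by
  rw [runSum]
  simp [Fintype.sum_prod_type, stepWeight, stackStep, EnterOK, enter, leave, leaveWeight]

/-- Without edges the stack never holds more than one entry. The sum is over the number `i` of
letters read before the one that closes this entry. -/
theorem runSum_bot_singleton (n j : ℕ) : runSum (⊥ : Digraph Unit) c n [((), j)] =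
    ∑ i ∈ Finset.range n, c (j + 2 + i) * runSum (⊥ : Digraph Unit) c (n - 1 - i) [] := by
  induction n generalizing j with
  | zero => rfl
  | succ n ih =>
    rw [runSum_bot_succ_singleton, ih, Finset.sum_range_succ', add_comm]
    congr 1
    refine Finset.sum_congr rfl fun i hi => ?_
    have e1 : j + 1 + 2 + i = j + 2 + (i + 1) := by omega
    have e2 : n - 1 - i = n + 1 - 1 - (i + 1) := by omega
    rw [e1, e2]

theorem runSum_bot_nil (n : ℕ) : runSum (⊥ : Digraph Unit) c (n + 1) [] =
    ∑ i ∈ Finset.range (n + 1), c (i + 1) * runSum (⊥ : Digraph Unit) c (n - i) [] := by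
  rw [runSum_bot_succ_nil, runSum_bot_singleton, Finset.sum_range_succ', add_comm]
  congr 1
  refine Finset.sum_congr rfl fun i hi => ?_
  have e1 : 0 + 2 + i = i + 1 + 1 := by omega
  have e2 : n - 1 - i = n - (i + 1) := by omega
  rw [e1, e2]

/-- A forest maps to the single vertex without edges in one way if it has no edges, and in no way
otherwise. The general count over non-crossing partitions thus reduces to interval partitions. -/
theorem runSum_bot_eq_sum_intervalPart (k : ℕ) : runSum (⊥ : Digraph Unit) c k [] =
    ∑ π ∈ intervalPart k, ∏ B ∈ π.parts, c B.card := by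
  classical
  have hsub : intervalPart k ⊆ nonCrossingPart k := by
    intro π hπ
    simp only [intervalPart, nonCrossingPart, Finset.mem_filter, Finset.mem_univ, true_and] at hπ ⊢
    exact (isInterval_iff_no_edge.1 hπ).1
  rw [runSum_eq_sum_hom, ← Finset.sum_subset hsub]
  · refine Finset.sum_congr rfl fun π hπ => ?_
    simp only [intervalPart, Finset.mem_filter, Finset.mem_univ, true_and] at hπ
    have h1 := (isInterval_iff_no_edge.1 hπ).2
    have : Unique (DigraphHom (nestingForest π) (⊥ : Digraph Unit)) :=
      { default := ⟨fun _ => (), fun {A B} h => absurd h (h1 A B)⟩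
        uniq := fun φ => by ext }
    rw [Nat.card_unique, Nat.cast_one, one_mul]
  · intro π hπ hπ'
    simp only [intervalPart, nonCrossingPart, Finset.mem_filter, Finset.mem_univ, true_and] at hπ hπ'
    have : IsEmpty (DigraphHom (nestingForest π) (⊥ : Digraph Unit)) :=
      ⟨fun φ => hπ' (isInterval_iff_no_edge.2 ⟨hπ, fun A B h => φ.map_rel h⟩)⟩
    rw [Nat.card_of_isEmpty, Nat.cast_zero, zero_mul]

end Recursion

/-- For |π| ≥ 1 the sign (-1)^{|π|-1} is absorbed by giving every block the weight `-moment`, up to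
one overall sign. -/
theorem boolCumulant_eq_neg_runSum (μ : ProbabilityMeasure ℝ) (k : ℕ) : boolCumulant μ (k + 1) =
    -runSum (⊥ : Digraph Unit) (fun j => -moment μ j) (k + 1) [] := by
  rw [runSum_bot_eq_sum_intervalPart, boolCumulant, ← Finset.sum_neg_distrib]
  refine Finset.sum_congr rfl fun π _ => ?_
  have h : π.parts.card ≠ 0 := by
    rw [Finset.card_ne_zero]
    exact ⟨_, part_mem_parts π 0⟩
  obtain ⟨n, hn⟩ := Nat.exists_eq_succ_of_ne_zero h
  rw [Finset.prod_neg, hn, Nat.succ_sub_one, Nat.succ_eq_add_one, pow_succ]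
  ring

/-- Splitting off the first block in the sum with weights `-moment` gives this recursion with the
roles of moments and cumulants exchanged; reversing the summation index restores them. -/
theorem moment_succ (μ : ProbabilityMeasure ℝ) (k : ℕ) : moment μ (k + 1) = boolCumulant μ (k + 1) +
    ∑ i ∈ Finset.range k, boolCumulant μ (i + 1) * moment μ (k - i) := by
  rw [boolCumulant_eq_neg_runSum, runSum_bot_nil, Finset.sum_range_succ, ← Finset.sum_range_reflect]
  have h1 : ∀ j ∈ Finset.range k,
      -moment μ (k - 1 - j + 1) * runSum (⊥ : Digraph Unit) (fun j => -moment μ j) (k - (k - 1 - j)) []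
        = boolCumulant μ (j + 1) * moment μ (k - j) := by
    intro j hj
    rw [Finset.mem_range] at hj
    have e1 : k - 1 - j + 1 = k - j := by omega
    have e2 : k - (k - 1 - j) = j + 1 := by omega
    rw [e1, e2, boolCumulant_eq_neg_runSum]
    ring
  rw [Finset.sum_congr rfl h1, Nat.sub_self]
  simp only [runSum]
  ring

/-! ### Boolean cumulants of operators -/

variable (K : PointedHilbert) (a : K.carrier →L[ℂ] K.carrier)

theorem PointedHilbert.coe_proj (K : PointedHilbert) (b : K.carrier) :
    (K.perp.orthogonalProjectionOnto b : K.carrier) = b - ⟪K.vec, b⟫_ℂ • K.vec := by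
  have h1 := Submodule.starProjection_orthogonal_val (K := Submodule.span ℂ {K.vec}) b
  rw [Submodule.starProjection_unit_singleton ℂ K.norm_vec] at h1
  exact h1

theorem apply_boolVec (j : ℕ) :
    a (boolVec K a j) = opCumulant K a (j + 1) • K.vec + boolVec K a (j + 1) := by
  rw [boolVec, PointedHilbert.coe_proj, opCumulant, Nat.add_sub_cancel]
  abel

theorem inner_vec_boolVec_succ (j : ℕ) : ⟪K.vec, boolVec K a (j + 1)⟫_ℂ = 0 :=
  K.inner_vec_perp _

/-- Iterating `apply_boolVec`, the index `i` records at which application of `a` the ξ-part is taken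
for the first time. -/
theorem inner_vec_pow_boolVec (n j : ℕ) : ⟪K.vec, (a ^ (n + 1)) (boolVec K a j)⟫_ℂ =
    ∑ i ∈ Finset.range (n + 1), opCumulant K a (j + i + 1) * ⟪K.vec, (a ^ (n - i)) K.vec⟫_ℂ := by
  induction n generalizing j with
  | zero =>
    simp [apply_boolVec, inner_vec_boolVec_succ]
  | succ n ih =>
    rw [pow_succ, mul_apply_eq_comp, apply_boolVec, map_add, inner_add_right, map_smul,
      inner_smul_right, ih, Finset.sum_range_succ' _ (n + 1), add_comm]
    congr 1
    refine Finset.sum_congr rfl fun i hi => ?_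
    have e1 : j + 1 + i + 1 = j + (i + 1) + 1 := by omega
    have e2 : n - i = n + 1 - (i + 1) := by omega
    rw [e1, e2]

theorem inner_vec_pow_succ (n : ℕ) : ⟪K.vec, (a ^ (n + 1)) K.vec⟫_ℂ = opCumulant K a (n + 1) +
    ∑ i ∈ Finset.range n, opCumulant K a (i + 1) * ⟪K.vec, (a ^ (n - i)) K.vec⟫_ℂ := by
  have h := inner_vec_pow_boolVec K a n 0
  rw [Finset.sum_range_succ, Nat.sub_self, pow_zero, one_apply_eq_self, K.inner_vec_vec, mul_one] at h
  simp only [zero_add] at h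
  rw [add_comm (opCumulant K a (n + 1))]
  exact h

variable {K a}

/-- The boolean cumulants of an operator are those of its distribution. -/
theorem boolCumulant_eq_opCumulant {μ : ProbabilityMeasure ℝ}
    (h : ∀ n, (moment μ n : ℂ) = ⟪K.vec, (a ^ n) K.vec⟫_ℂ) (n : ℕ) (hn : 1 ≤ n) :
    (boolCumulant μ n : ℂ) = opCumulant K a n := by
  induction n using Nat.strong_induction_on with
  | _ n ih =>
    obtain ⟨n, rfl⟩ := Nat.exists_eq_add_of_le' hn
    have h1 := inner_vec_pow_succ K a n
    rw [← h, moment_succ] at h1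
    simp only [Complex.ofReal_add, Complex.ofReal_sum, Complex.ofReal_mul] at h1
    have h2 : ∑ i ∈ Finset.range n, (boolCumulant μ (i + 1) : ℂ) * (moment μ (n - i) : ℂ) =
        ∑ i ∈ Finset.range n, opCumulant K a (i + 1) * ⟪K.vec, (a ^ (n - i)) K.vec⟫_ℂ := by
      refine Finset.sum_congr rfl fun i hi => ?_
      rw [Finset.mem_range] at hi
      rw [ih (i + 1) (by omega) (by omega), h]
    rw [h2] at h1
    exact add_right_cancel h1

theorem norm_boolVec_le {r : ℝ} (hr : ‖a‖ ≤ r) (j : ℕ) : ‖boolVec K a j‖ ≤ r ^ j := by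
  have hr0 : 0 ≤ r := (norm_nonneg a).trans hr
  induction j with
  | zero => simp [boolVec, K.norm_vec]
  | succ j ih =>
    calc ‖boolVec K a (j + 1)‖ ≤ ‖a (boolVec K a j)‖ :=
          K.perp.norm_orthogonalProjectionOnto_apply_le _
      _ ≤ ‖a‖ * ‖boolVec K a j‖ := a.le_opNorm _
      _ ≤ r * r ^ j := by gcongr
      _ = r ^ (j + 1) := by ring

theorem norm_opCumulant_le {r : ℝ} (hr : ‖a‖ ≤ r) (j : ℕ) (hj : 1 ≤ j) :
    ‖opCumulant K a j‖ ≤ r ^ j := by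
  have hr0 : 0 ≤ r := (norm_nonneg a).trans hr
  obtain ⟨j, rfl⟩ := Nat.exists_eq_add_of_le' hj
  calc ‖opCumulant K a (j + 1)‖ ≤ ‖K.vec‖ * ‖a (boolVec K a j)‖ := norm_inner_le_norm _ _
    _ ≤ 1 * (‖a‖ * ‖boolVec K a j‖) := by
        rw [K.norm_vec]
        gcongr
        exact a.le_opNorm _
    _ ≤ 1 * (r * r ^ j) := by
        gcongr
        exact norm_boolVec_le hr j
    _ = r ^ (j + 1) := by ring

end Cumulants

/-! ### Boolean powers of operators -/

section BoolPow

variable (K : PointedHilbert) (a : K.carrier →L[ℂ] K.carrier) (s : ℝ)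

/-- The operator that multiplies `ξ` by `s` and is the identity on `H°`. -/
def vecScale : K.carrier →L[ℂ] K.carrier :=
  ContinuousLinearMap.id ℂ K.carrier + ((s - 1 : ℝ) : ℂ) • (innerSL ℂ K.vec).smulRight K.vec

theorem vecScale_apply (b : K.carrier) :
    vecScale K s b = b + ((s - 1 : ℝ) : ℂ) • ⟪K.vec, b⟫_ℂ • K.vec := rfl

theorem isSelfAdjoint_vecScale : IsSelfAdjoint (vecScale K s) := by
  rw [ContinuousLinearMap.isSelfAdjoint_iff_isSymmetric]
  intro b b'
  change ⟪vecScale K s b, b'⟫_ℂ = ⟪b, vecScale K s b'⟫_ℂ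
  simp only [vecScale_apply, inner_add_left, inner_add_right, inner_smul_left, inner_smul_right,
    Complex.conj_ofReal, inner_conj_symm]
  ring

theorem vecScale_vec : vecScale K s K.vec = (s : ℂ) • K.vec := by
  rw [vecScale_apply, K.inner_vec_vec, one_smul]
  push_cast
  rw [sub_smul, one_smul]
  abel

theorem vecScale_perp (b : K.perp) : vecScale K s b = b := by
  rw [vecScale_apply, K.inner_vec_perp, zero_smul, smul_zero, add_zero]

theorem proj_vecScale (b : K.carrier) : K.perp.orthogonalProjectionOnto (vecScale K s b) =
    K.perp.orthogonalProjectionOnto b := by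
  rw [vecScale_apply, map_add, map_smul, map_smul, K.proj_vec, smul_zero, smul_zero, add_zero]

theorem inner_vec_vecScale (b : K.carrier) :
    ⟪K.vec, vecScale K s b⟫_ℂ = s * ⟪K.vec, b⟫_ℂ := by
  rw [vecScale_apply, inner_add_right, inner_smul_right, inner_smul_right, K.inner_vec_vec]
  push_cast
  ring

theorem boolVec_vecScale (j : ℕ) : boolVec K (vecScale K s ∘L a ∘L vecScale K s) (j + 1) =
    (s : ℂ) • boolVec K a (j + 1) := by
  induction j with
  | zero =>
    simp only [boolVec, ContinuousLinearMap.comp_apply, proj_vecScale, vecScale_vec, map_smul]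
    rfl
  | succ j ih =>
    rw [boolVec, ih, ContinuousLinearMap.comp_apply, ContinuousLinearMap.comp_apply, proj_vecScale,
      map_smul, boolVec, vecScale_perp, map_smul, map_smul]
    rfl

/-- With a' = DaD, the operator D acts nontrivially only on ξ, and each cumulant ⟨ξ, a'(Qa')^{j-1}ξ⟩
meets ξ just at its two ends. Each end contributes one factor `s`. -/
theorem opCumulant_vecScale (j : ℕ) (hj : 1 ≤ j) :
    opCumulant K (vecScale K s ∘L a ∘L vecScale K s) j = (s ^ 2 : ℝ) * opCumulant K a j := by
  obtain ⟨j, rfl⟩ := Nat.exists_eq_add_of_le' hj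
  rw [opCumulant, opCumulant, Nat.add_sub_cancel, ContinuousLinearMap.comp_apply,
    ContinuousLinearMap.comp_apply, inner_vec_vecScale]
  cases j with
  | zero =>
    rw [boolVec, boolVec, vecScale_vec, map_smul, inner_smul_right]
    push_cast
    ring
  | succ j =>
    rw [boolVec_vecScale, map_smul, boolVec, vecScale_perp, map_smul, inner_smul_right]
    push_cast
    ring

end BoolPow

/-! ### Compactly supported measures and spectral distributions -/

section Measures

theorem ae_enorm_le_rad (μ : ProbabilityMeasure ℝ) : ∀ᵐ x ∂(μ : Measure ℝ), ‖x‖ₑ ≤ rad μ := by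
  filter_upwards [Measure.support_mem_ae (μ := (μ : Measure ℝ))] with x hx
  exact le_iSup₂ (f := fun x _ => ‖x‖ₑ) x hx

theorem rad_lt_top {μ : ProbabilityMeasure ℝ} (hμ : IsCompactlySupported μ) : rad μ < ⊤ := by
  obtain ⟨C, hC⟩ := hμ.isBounded.exists_norm_le
  refine lt_of_le_of_lt (iSup₂_le fun x hx => ?_) (ENNReal.ofReal_lt_top (r := C))
  rw [← ofReal_norm]
  exact ENNReal.ofReal_le_ofReal (hC x hx)

theorem ae_abs_le_of_rad_le {μ : ProbabilityMeasure ℝ} {r : ℝ} (hr : 0 ≤ r)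
    (h : rad μ ≤ ENNReal.ofReal r) : ∀ᵐ x ∂(μ : Measure ℝ), |x| ≤ r := by
  filter_upwards [ae_enorm_le_rad μ] with x hx
  have := hx.trans h
  rwa [← ofReal_norm, ENNReal.ofReal_le_ofReal_iff hr] at this

theorem integrable_of_continuous_of_ae_abs_le {μ : ProbabilityMeasure ℝ} {r : ℝ}
    (h : ∀ᵐ x ∂(μ : Measure ℝ), |x| ≤ r) {f : ℝ → ℝ} (hf : Continuous f) :
    Integrable f (μ : Measure ℝ) := by
  obtain ⟨C, hC⟩ := (isCompact_Icc (a := -r) (b := r)).exists_bound_of_continuousOn hf.continuousOn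
  refine Integrable.of_bound hf.aestronglyMeasurable C ?_
  filter_upwards [h] with x hx
  exact hC x (abs_le.1 hx)

/-- A support point beyond `C` gives positive mass to {|y| > r} for some r > C. By Markov's
inequality for even moments this mass is at most (C/r)^{2n}, which tends to 0. -/
theorem rad_le_of_abs_moment_le {μ : ProbabilityMeasure ℝ} (hμ : IsCompactlySupported μ) {C : ℝ}
    (hC : 0 ≤ C) (h : ∀ k, |moment μ k| ≤ C ^ k) : rad μ ≤ ENNReal.ofReal C := by
  refine iSup₂_le fun x hx => ?_
  rw [← ofReal_norm, ENNReal.ofReal_le_ofReal_iff hC, Real.norm_eq_abs]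
  by_contra! hlt
  obtain ⟨r, hCr, hrx⟩ := exists_between hlt
  have hr : 0 < r := hC.trans_lt hCr
  have hint : ∀ k : ℕ, Integrable (fun y : ℝ => y ^ k) (μ : Measure ℝ) := fun k =>
    integrable_of_continuous_of_ae_abs_le
      (ae_abs_le_of_rad_le (r := (rad μ).toReal) ENNReal.toReal_nonneg
        (by rw [ENNReal.ofReal_toReal (rad_lt_top hμ).ne])) (by fun_prop)
  have hU : IsOpen {y : ℝ | r < |y|} := isOpen_lt continuous_const continuous_abs
  have hδ : 0 < (μ : Measure ℝ) {y : ℝ | r < |y|} :=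
    (Measure.mem_support_iff_forall x).1 hx _ (hU.mem_nhds hrx)
  have hδ' : 0 < (μ : Measure ℝ).real {y : ℝ | r < |y|} :=
    ENNReal.toReal_pos hδ.ne' (measure_ne_top _ _)
  have key : ∀ n : ℕ, (μ : Measure ℝ).real {y : ℝ | r < |y|} ≤ ((C / r) ^ 2) ^ n := by
    intro n
    have h1 : r ^ (2 * n) * (μ : Measure ℝ).real {y : ℝ | r < |y|} ≤ moment μ (2 * n) := by
      calc r ^ (2 * n) * (μ : Measure ℝ).real {y : ℝ | r < |y|}
          = ∫ y in {y : ℝ | r < |y|}, r ^ (2 * n) ∂(μ : Measure ℝ) := by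
            rw [setIntegral_const, smul_eq_mul, mul_comm]
        _ ≤ ∫ y in {y : ℝ | r < |y|}, y ^ (2 * n) ∂(μ : Measure ℝ) := by
            refine setIntegral_mono_on (integrable_const _) (hint _).integrableOn hU.measurableSet
              fun y hy => ?_
            rw [← Even.pow_abs (even_two_mul n) y]
            exact pow_le_pow_left₀ hr.le (le_of_lt hy) _
        _ ≤ ∫ y, y ^ (2 * n) ∂(μ : Measure ℝ) :=
            setIntegral_le_integral (hint _)
              (Eventually.of_forall fun y => (even_two_mul n).pow_nonneg y)
    have h2 := h1.trans ((le_abs_self _).trans (h (2 * n)))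
    rw [← pow_mul, div_pow, le_div_iff₀ (by positivity), mul_comm]
    exact h2
  have hlim : Tendsto (fun n : ℕ => ((C / r) ^ 2) ^ n) atTop (𝓝 0) := by
    refine tendsto_pow_atTop_nhds_zero_of_lt_one (by positivity) ?_
    refine pow_lt_one₀ (by positivity) ?_ two_ne_zero
    rwa [div_lt_one hr]
  exact absurd (ge_of_tendsto' hlim key) (not_le.2 hδ')

/-- Convergence of moments implies weak convergence for uniformly bounded supports. -/
theorem exists_tendsto_of_tendsto_moment (ν : ℕ → ProbabilityMeasure ℝ) {r : ℝ} (hr : 0 ≤ r)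
    (hν : ∀ n, rad (ν n) ≤ ENNReal.ofReal r) (l : ℕ → ℝ)
    (hl : ∀ k, Tendsto (fun n => moment (ν n) k) atTop (𝓝 (l k))) :
    ∃ μ, Tendsto ν atTop (𝓝 μ) := by
  have hae := fun n => ae_abs_le_of_rad_le hr (hν n)
  have hpoly : ∀ p : Polynomial ℝ, CauchySeq fun n => ∫ x, p.eval x ∂(ν n : Measure ℝ) := by
    intro p
    have h1 : ∀ n, ∫ x, p.eval x ∂(ν n : Measure ℝ) =
        ∑ i ∈ Finset.range (p.natDegree + 1), p.coeff i * moment (ν n) i := by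
      intro n
      simp only [Polynomial.eval_eq_sum_range]
      rw [integral_finsetSum _ fun i _ =>
        integrable_of_continuous_of_ae_abs_le (hae n) (by fun_prop)]
      exact Finset.sum_congr rfl fun i _ => integral_const_mul _ _
    simp only [h1]
    exact (tendsto_finsetSum _ fun i _ => (hl i).const_mul (p.coeff i)).cauchySeq
  have hcont : ∀ f : BoundedContinuousFunction ℝ ℝ,
      ∃ L, Tendsto (fun n => ∫ x, f x ∂(ν n : Measure ℝ)) atTop (𝓝 L) := by
    intro f
    -- By Weierstrass approximation on the common interval, an error ε/3 is paid twice for replacing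
    -- `f` by a polynomial and once for the Cauchy property of its integrals.
    refine cauchySeq_tendsto_of_complete (Metric.cauchySeq_iff.2 fun ε hε => ?_)
    obtain ⟨p, hp⟩ := exists_polynomial_near_of_continuousOn (-r) r f f.continuous.continuousOn
      (ε / 3) (by positivity)
    obtain ⟨N, hN⟩ := Metric.cauchySeq_iff.1 (hpoly p) (ε / 3) (by positivity)
    have happrox : ∀ n, |∫ x, p.eval x ∂(ν n : Measure ℝ) - ∫ x, f x ∂(ν n : Measure ℝ)| ≤
        ε / 3 := by
      intro n
      rw [← integral_sub (integrable_of_continuous_of_ae_abs_le (hae n) (by fun_prop))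
        (integrable_of_continuous_of_ae_abs_le (hae n) f.continuous)]
      have := norm_integral_le_of_norm_le_const (μ := (ν n : Measure ℝ)) (C := ε / 3)
        (f := fun x => p.eval x - f x) (by
          filter_upwards [hae n] with x hx
          exact (hp x (abs_le.1 hx)).le)
      simpa using this
    refine ⟨N, fun m hm n hn => ?_⟩
    have h1 := abs_le.1 (happrox m)
    have h2 := abs_le.1 (happrox n)
    have h3 := abs_lt.1 (by simpa only [Real.dist_eq] using hN m hm n hn)
    rw [Real.dist_eq, abs_lt]
    constructor <;> linarith
  have htight : IsTightMeasureSet {((μ : ProbabilityMeasure ℝ) : Measure ℝ) | μ ∈ Set.range ν} := by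
    rw [isTightMeasureSet_iff_exists_isCompact_measure_compl_le]
    refine fun ε _ => ⟨Set.Icc (-r) r, isCompact_Icc, ?_⟩
    rintro _ ⟨_, ⟨n, rfl⟩, rfl⟩
    have : (ν n : Measure ℝ) (Set.Icc (-r) r)ᶜ = 0 := by
      rw [← mem_ae_iff]
      filter_upwards [hae n] with x hx
      exact abs_le.1 hx
    rw [this]
    exact zero_le
  obtain ⟨μ, -, hμ⟩ := (isCompact_closure_of_isTightMeasureSet htight).exists_mapClusterPt_of_frequently
    (l := atTop) (f := ν)
    (Eventually.of_forall fun n => subset_closure (Set.mem_range_self n)).frequently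
  refine ⟨μ, ProbabilityMeasure.tendsto_iff_forall_integral_tendsto.2 fun f => ?_⟩
  obtain ⟨L, hL⟩ := hcont f
  -- Tightness has provided a cluster point `μ`. Its integral of `f` is a cluster point of a
  -- convergent sequence, hence equals the limit `L`.
  have h1 := hμ.continuousAt_comp
    (ProbabilityMeasure.continuous_integral_boundedContinuousFunction f).continuousAt
  have h2 : ∫ x, f x ∂(μ : Measure ℝ) = L := by
    have h3 : ClusterPt _ (𝓝 L) := ClusterPt.mono h1 hL
    exact eq_of_nhds_neBot h3
  rw [h2]
  exact hL

/-! ### Moments and supports of spectral distributions -/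

section Spectral

universe u

variable {E : Type u} [NormedAddCommGroup E] [InnerProductSpace ℂ E] [CompleteSpace E]

theorem ofReal_moment_spectralDistribution (T : E →L[ℂ] E) (hT : IsSelfAdjoint T) (ξ : E)
    (hξ : ‖ξ‖ = 1) (k : ℕ) :
    (moment (spectralDistribution T hT ξ hξ) k : ℂ) = ⟪ξ, (T ^ k) ξ⟫_ℂ := by
  let f : C_c(spectrum ℝ T, ℝ) :=
    ⟨((ContinuousMap.id ℝ).restrict (spectrum ℝ T)) ^ k, HasCompactSupport.of_compactSpace _⟩
  have h1 : moment (spectralDistribution T hT ξ hξ) k = (⟪ξ, (T ^ k) ξ⟫_ℂ).re := by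
    change ∫ x, x ^ k ∂(RealRMK.rieszMeasure (vectorState T hT ξ)).map Subtype.val = _
    rw [integral_map measurable_subtype_coe.aemeasurable (by fun_prop)]
    refine (RealRMK.integral_rieszMeasure (vectorState T hT ξ) f).trans ?_
    change (⟪ξ, cfcHom hT (((ContinuousMap.id ℝ).restrict (spectrum ℝ T)) ^ k) ξ⟫_ℂ).re = _
    rw [map_pow, cfcHom_id]
  rw [h1]
  -- The real part in the definition of the state loses nothing, since powers of a self-adjoint
  -- operator have real diagonal matrix elements.
  refine Complex.conj_eq_iff_re.1 ?_
  rw [inner_conj_symm]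
  exact ContinuousLinearMap.isSelfAdjoint_iff_isSymmetric.1 (hT.pow k) ξ ξ

theorem isCompactlySupported_spectralDistribution (T : E →L[ℂ] E) (hT : IsSelfAdjoint T) (ξ : E)
    (hξ : ‖ξ‖ = 1) : IsCompactlySupported (spectralDistribution T hT ξ hξ) := by
  have hc : IsCompact (spectrum ℝ T) := spectrum.isCompact T
  refine hc.of_isClosed_subset Measure.isClosed_support
    (Measure.support_subset_of_isClosed hc.isClosed ?_)
  change spectrum ℝ T ∈ ae ((RealRMK.rieszMeasure (vectorState T hT ξ)).map Subtype.val)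
  rw [mem_ae_map_iff measurable_subtype_coe.aemeasurable hc.measurableSet]
  filter_upwards with x
  exact x.2

end Spectral

/-! ### Multiplication by the coordinate -/

theorem memLp_coord {μ : ProbabilityMeasure ℝ} {r : ℝ} (h : ∀ᵐ x ∂(μ : Measure ℝ), |x| ≤ r) :
    MemLp (fun x : ℝ => (x : ℂ)) ∞ (μ : Measure ℝ) := by
  refine memLp_top_of_bound (by fun_prop) r ?_
  filter_upwards [h] with x hx
  simpa using hx

theorem norm_coordOp_le {μ : ProbabilityMeasure ℝ} {r : ℝ} (hr : 0 ≤ r)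
    (h : ∀ᵐ x ∂(μ : Measure ℝ), |x| ≤ r) : ‖coordOp μ‖ ≤ r := by
  have hm := memLp_coord h
  rw [coordOp, dif_pos hm]
  refine (LinearMap.mkContinuous_norm_le _ (norm_nonneg _) _).trans ?_
  rw [Lp.norm_toLp, eLpNorm_exponent_top]
  refine ENNReal.toReal_le_of_le_ofReal hr (eLpNormEssSup_le_of_ae_bound ?_)
  filter_upwards [h] with x hx
  simpa using hx

theorem ofReal_moment_coordOp {μ : ProbabilityMeasure ℝ} {r : ℝ}
    (h : ∀ᵐ x ∂(μ : Measure ℝ), |x| ≤ r) (n : ℕ) :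
    (moment μ n : ℂ) = ⟪(ltwo μ).vec, (coordOp μ ^ n) (ltwo μ).vec⟫_ℂ := by
  have hm := memLp_coord h
  have key : ∀ n, ∃ g : Lp ℂ 2 (μ : Measure ℝ), (coordOp μ ^ n) (ltwo μ).vec = g ∧
      g =ᵐ[(μ : Measure ℝ)] fun x => (x : ℂ) ^ n := by
    intro n
    induction n with
    | zero =>
      refine ⟨Lp.const 2 (μ : Measure ℝ) (1 : ℂ), rfl, ?_⟩
      filter_upwards [Lp.coeFn_const (p := 2) (μ := (μ : Measure ℝ)) (1 : ℂ)] with x hx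
      rw [hx]
      simp
    | succ n ih =>
      obtain ⟨g, hg1, hg2⟩ := ih
      refine ⟨hm.toLp • g, ?_, ?_⟩
      · rw [pow_succ', mul_apply_eq_comp, hg1, coordOp, dif_pos hm]
        rfl
      · filter_upwards [Lp.coeFn_lpSMul (r := 2) hm.toLp g, hg2, hm.coeFn_toLp] with x h1 h2 h3
        rw [h1, Pi.smul_apply', h2, h3, smul_eq_mul, pow_succ']
  obtain ⟨g, hg1, hg2⟩ := key n
  rw [hg1]
  change _ = ⟪Lp.const 2 (μ : Measure ℝ) (1 : ℂ), g⟫_ℂ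
  rw [L2.inner_def, moment, ← integral_complex_ofReal]
  refine integral_congr_ae ?_
  filter_upwards [Lp.coeFn_const (p := 2) (μ := (μ : Measure ℝ)) (1 : ℂ), hg2] with x h1 h2
  rw [h1, h2]
  simp

theorem ae_abs_le_toReal_rad {μ : ProbabilityMeasure ℝ} (hμ : IsCompactlySupported μ) :
    ∀ᵐ x ∂(μ : Measure ℝ), |x| ≤ (rad μ).toReal :=
  ae_abs_le_of_rad_le ENNReal.toReal_nonneg (by rw [ENNReal.ofReal_toReal (rad_lt_top hμ).ne])

theorem boolCumulant_eq_opCumulant_coordOp {μ : ProbabilityMeasure ℝ}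
    (hμ : IsCompactlySupported μ) (n : ℕ) (hn : 1 ≤ n) :
    (boolCumulant μ n : ℂ) = opCumulant (ltwo μ) (coordOp μ) n :=
  boolCumulant_eq_opCumulant (ofReal_moment_coordOp (ae_abs_le_toReal_rad hμ)) n hn

/-- The cumulant is a matrix element of a product of `n` copies of the coordinate operator, of norm
at most the radius, with projections in between. The alternating sum over interval partitions would
not show this bound. -/
theorem abs_boolCumulant_le {μ : ProbabilityMeasure ℝ} (hμ : IsCompactlySupported μ) (n : ℕ)
    (hn : 1 ≤ n) : |boolCumulant μ n| ≤ (rad μ).toReal ^ n := by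
  have h := norm_opCumulant_le
    (norm_coordOp_le ENNReal.toReal_nonneg (ae_abs_le_toReal_rad hμ)) n hn
  rwa [← boolCumulant_eq_opCumulant_coordOp hμ n hn, Complex.norm_real, Real.norm_eq_abs] at h

/-- Boolean convolution powers exist. -/
theorem exists_isBoolPow {μ : ProbabilityMeasure ℝ} (hμ : IsCompactlySupported μ) {t : ℝ}
    (ht : 0 ≤ t) : ∃ ν, IsBoolPow μ t ν := by
  set K := ltwo μ with hK
  -- Cumulants scale by the square of the factor on ξ, hence the square root of `t`.
  set D := vecScale K (Real.sqrt t)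
  have hsa : IsSelfAdjoint (D ∘L coordOp μ ∘L D) := by
    have h := (isSelfAdjoint_coordOp μ).conj_adjoint D
    rwa [(isSelfAdjoint_vecScale K (Real.sqrt t)).adjoint_eq] at h
  refine ⟨spectralDistribution _ hsa K.vec K.norm_vec,
    isCompactlySupported_spectralDistribution _ _ _ _, fun k hk => ?_⟩
  have h := boolCumulant_eq_opCumulant
    (ofReal_moment_spectralDistribution _ hsa K.vec K.norm_vec) k hk
  rw [opCumulant_vecScale K _ _ k hk, ← boolCumulant_eq_opCumulant_coordOp hμ k hk,
    Real.sq_sqrt ht] at h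
  exact_mod_cast h

theorem isBoolPow_boolPow {μ : ProbabilityMeasure ℝ} (hμ : IsCompactlySupported μ) {t : ℝ}
    (ht : 0 ≤ t) : IsBoolPow μ t (boolPow μ t) := by
  have h := exists_isBoolPow hμ ht
  rw [boolPow, dif_pos h]
  exact h.choose_spec

end Measures

/-! ### Moments of free convolution powers -/

section FreeConv

universe u

variable {V : Type u} [Fintype V] (G : Digraph V) [Std.Irrefl G.Adj]

theorem one_le_card_of_mem_parts {k : ℕ} {π : Part k} {B : Finset (Fin k)} (hB : B ∈ π.parts) :
    1 ≤ B.card :=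
  Finset.card_pos.2 (π.nonempty_of_mem_parts hB)

/-- This exact formula on a fixed digraph contains all the operator theory needed for the limit
theorem. -/
theorem moment_freeConvPow {ν : ProbabilityMeasure ℝ} (hν : IsCompactlySupported ν) (k : ℕ) :
    moment (freeConvPow G ν) k = ∑ π ∈ nonCrossingPart k,
      (Nat.card (DigraphHom (nestingForest π) G) : ℝ) * ∏ B ∈ π.parts, boolCumulant ν B.card := by
  have h : (moment (freeConvPow G ν) k : ℂ) = _ :=
    (ofReal_moment_spectralDistribution _ _ _ (norm_vacuum G _) k).trans
      (inner_vacuum_pow_sum_iota G (ltwo ν) (coordOp ν) k)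
  apply Complex.ofReal_injective
  rw [h]
  push_cast
  refine Finset.sum_congr rfl fun π _ => ?_
  congr 1
  exact Finset.prod_congr rfl fun B hB =>
    (boolCumulant_eq_opCumulant_coordOp hν _ (one_le_card_of_mem_parts hB)).symm

/-- One factor 1/|V| per block produces the normalisation of the homomorphism density of the nesting
forest. Only the cumulants of the boolean power enter, so its uniqueness plays no role. -/
theorem moment_freeConvPow_boolPow {μ : ProbabilityMeasure ℝ} (hμ : IsCompactlySupported μ) (k : ℕ) :
    moment (freeConvPow G (boolPow μ (1 / (Fintype.card V : ℝ)))) k = ∑ π ∈ nonCrossingPart k,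
      (Nat.card (DigraphHom (nestingForest π) G) : ℝ) /
        (Fintype.card V : ℝ) ^ Fintype.card π.parts * ∏ B ∈ π.parts, boolCumulant μ B.card := by
  obtain ⟨h1, h2⟩ := isBoolPow_boolPow hμ (t := 1 / (Fintype.card V : ℝ)) (by positivity)
  rw [moment_freeConvPow G h1]
  refine Finset.sum_congr rfl fun π _ => ?_
  rw [Finset.prod_congr rfl fun B hB => h2 _ (one_le_card_of_mem_parts hB),
    Finset.prod_mul_distrib, Finset.prod_const, Fintype.card_coe, one_div, inv_pow]
  ring

theorem abs_moment_freeConvPow_boolPow_le [Nonempty V] {μ : ProbabilityMeasure ℝ}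
    (hμ : IsCompactlySupported μ) (k : ℕ) :
    |moment (freeConvPow G (boolPow μ (1 / (Fintype.card V : ℝ)))) k| ≤
      (4 * (rad μ).toReal) ^ k := by
  have hV : 0 < (Fintype.card V : ℝ) := Nat.cast_pos.2 Fintype.card_pos
  rw [moment_freeConvPow_boolPow G hμ]
  have hterm : ∀ π ∈ nonCrossingPart k, |(Nat.card (DigraphHom (nestingForest π) G) : ℝ) /
        (Fintype.card V : ℝ) ^ Fintype.card π.parts * ∏ B ∈ π.parts, boolCumulant μ B.card| ≤
      (rad μ).toReal ^ k := by
    intro π _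
    have h1 : (Nat.card (DigraphHom (nestingForest π) G) : ℝ) /
        (Fintype.card V : ℝ) ^ Fintype.card π.parts ≤ 1 := by
      rw [div_le_one (by positivity)]
      exact_mod_cast natCard_digraphHom_le (nestingForest π) G
    have h2 : |∏ B ∈ π.parts, boolCumulant μ B.card| ≤ (rad μ).toReal ^ k := by
      have h3 : ∑ B ∈ π.parts, B.card = k := by
        rw [π.sum_card_parts, Finset.card_univ, Fintype.card_fin]
      rw [Finset.abs_prod]
      refine (Finset.prod_le_prod (fun _ _ => abs_nonneg _) fun B hB =>
        abs_boolCumulant_le hμ _ (one_le_card_of_mem_parts hB)).trans_eq ?_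
      rw [Finset.prod_pow_eq_pow_sum, h3]
    rw [abs_mul, abs_of_nonneg (by positivity)]
    exact (mul_le_mul h1 h2 (abs_nonneg _) zero_le_one).trans_eq (one_mul _)
  refine (Finset.abs_sum_le_sum_abs _ _).trans ((Finset.sum_le_sum hterm).trans ?_)
  rw [Finset.sum_const, nsmul_eq_mul, mul_pow]
  gcongr
  exact_mod_cast card_nonCrossingPart_le k

theorem rad_freeConvPow_boolPow_le [Nonempty V] {μ : ProbabilityMeasure ℝ}
    (hμ : IsCompactlySupported μ) :
    rad (freeConvPow G (boolPow μ (1 / (Fintype.card V : ℝ)))) ≤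
      ENNReal.ofReal (4 * (rad μ).toReal) :=
  rad_le_of_abs_moment_le (isCompactlySupported_spectralDistribution _ _ _ (norm_vacuum G _))
    (by positivity)     (abs_moment_freeConvPow_boolPow_le G hμ)

end FreeConv

end GFree

end

/-! ### The limit theorem -/

theorem mainTheorem12 {V : ℕ → Type*} [∀ n, Fintype (V n)] [∀ n, Nonempty (V n)]
    (G : ∀ n, Digraph (V n)) [∀ n, Std.Irrefl (G n).Adj]
    (β : (W : Type) → Digraph W → ℝ)
    (hβ : ∀ (W : Type) [Fintype W] (T : Digraph W), IsRootedTree T →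
      Tendsto (fun n => (Nat.card (DigraphHom T (G n)) : ℝ) /
        (Fintype.card (V n) : ℝ) ^ Fintype.card W) atTop (𝓝 (β W T)))
    (μ : ProbabilityMeasure ℝ) (hμ : IsCompactlySupported μ) :
    (∀ k : ℕ, Tendsto
      (fun n => moment (freeConvPow (G n) (boolPow μ (1 / (Fintype.card (V n) : ℝ)))) k) atTop
      (𝓝 (∑ π ∈ nonCrossingPart k, forestCoeff β (nestingForest π) *
        ∏ B ∈ π.parts, boolCumulant μ B.card))) ∧
    (∀ n, rad (freeConvPow (G n) (boolPow μ (1 / (Fintype.card (V n) : ℝ)))) ≤ 4 * rad μ) ∧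
    ∃ ν : ProbabilityMeasure ℝ, Tendsto
      (fun n => freeConvPow (G n) (boolPow μ (1 / (Fintype.card (V n) : ℝ)))) atTop (𝓝 ν) := by
  have hpos : ∀ n, rad (freeConvPow (G n) (boolPow μ (1 / (Fintype.card (V n) : ℝ)))) ≤
      ENNReal.ofReal (4 * (rad μ).toReal) := fun n => rad_freeConvPow_boolPow_le (G n) hμ
  have hmom : ∀ k : ℕ, Tendsto
      (fun n => moment (freeConvPow (G n) (boolPow μ (1 / (Fintype.card (V n) : ℝ)))) k) atTop
      (𝓝 (∑ π ∈ nonCrossingPart k, forestCoeff β (nestingForest π) *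
        ∏ B ∈ π.parts, boolCumulant μ B.card)) := by
    intro k
    -- For fixed `k` the sum over partitions is finite and independent of `n`; only the densities
    -- vary, so the limit is taken termwise.
    simp only [moment_freeConvPow_boolPow _ hμ]
    refine tendsto_finsetSum _ fun π hπ => Tendsto.mul_const _ ?_
    have hπ' : IsNonCrossing π := by simpa [nonCrossingPart] using hπ
    exact tendsto_forestCoeff G β hβ (nestingForest π) (nestingForest_parent_unique hπ') blockRank
      (blockRank_lt hπ')
  refine ⟨hmom, fun n => (hpos n).trans_eq ?_, ?_⟩
  · rw [ENNReal.ofReal_mul (by norm_num), ENNReal.ofReal_toReal (rad_lt_top hμ).ne]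
    norm_num
  · exact exists_tendsto_of_tendsto_moment _ (by positivity) hpos _ hmom
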